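/- Let $B$ be a smooth complete irreducible curve over $\mathbb{C}$ (of any genus), let $0\le p<N$ be integers, and let $G=G(p,N)$ be the Grassmannian of $p$-dimensional linear subspaces of $\mathbb{P}^N$, with $\mathcal{O}_G(1)$ the Plücker line bundle; thus $\dim G=(p+1)(N-p)$ and $G$ has index $N+1$. Let $c\ge 0$, let $k_1,\dots,k_c$ be positive integers with $$\sum_{i=1}^c k_i<N+1,$$ and let $\mathcal{L}_1,\dots,\mathcal{L}_c$ be line bundles on $B$. For each $i$ let $\sigma_i$ be a global section of $\mathrm{pr}_G^*\mathcal{O}_G(k_i)\otimes \mathrm{pr}_B^*\mathcal{L}_i$ on $B\times G$, with zero scheme $H_i$, and let $H=H_1\cap\dots\cap H_c\subset B\times G$ be the scheme-theoretic intersection. Assume that $H$ is a relatively smooth complete intersection over the general point of $B$: there is a nonempty open set $U\subset B$ over which the projection $H\to B$ is smooth of relative dimension $\dim G-c$ (in particular, $U=B$ is allowed). Then $H\to B$ has a section, that is, there is a morphism $s\colon B\to H$ whose composition with the projection $H\to B$ is $\mathrm{id}_B$. -/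

import Mathlib

open AlgebraicGeometry CategoryTheory

noncomputable section

namespace GrassTsen

/-! ### The Grassmannian in its Plücker embedding -/

/-- The Plücker index set: `(p+1)`-element subsets `{i₀ < ⋯ < i_p}` of `{0, …, N}`. -/
abbrev PluckerIndex (p N : ℕ) : Type := Fin (p + 1) ↪o Fin (N + 1)

/-- The maximal minor with column set `I` of the generic `(p+1) × (N+1)` matrix. -/
def minor (p N : ℕ) (I : PluckerIndex p N) : MvPolynomial (Fin (p + 1) × Fin (N + 1)) ℂ :=
  Matrix.det (Matrix.of fun i j : Fin (p + 1) => MvPolynomial.X (i, I j))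

/-- The map `ℂ[x_I] → ℂ[s_{ij}]` that sends each Plücker coordinate to the corresponding minor.
Its kernel is the ideal of all polynomials that vanish on every decomposable vector
`s₀ ∧ ⋯ ∧ s_p`. -/
def pluckerMap (p N : ℕ) : MvPolynomial (PluckerIndex p N) ℂ →ₐ[ℂ]
    MvPolynomial (Fin (p + 1) × Fin (N + 1)) ℂ :=
  MvPolynomial.aeval (minor p N)

/-- The homogeneous coordinate ring `ℂ[x_I] / (Plücker relations)` of the Grassmannian in its
Plücker embedding, realized as the subalgebra generated by the maximal minors. -/
abbrev PluckerRing (p N : ℕ) : Type := (pluckerMap p N).range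

/-- The grading of the Plücker ring by the degree in the Plücker coordinates. -/
def pluckerGrading (p N : ℕ) (k : ℕ) : Submodule ℂ (PluckerRing p N) :=
  (MvPolynomial.homogeneousSubmodule (PluckerIndex p N) ℂ k).map
    (pluckerMap p N).rangeRestrict.toLinearMap

/-- The Plücker coordinate `x_I`. -/
def coord (p N : ℕ) (I : PluckerIndex p N) : PluckerRing p N :=
  (pluckerMap p N).rangeRestrict (MvPolynomial.X I)

lemma coord_mem (p N : ℕ) (I : PluckerIndex p N) : coord p N I ∈ pluckerGrading p N 1 :=
  ⟨MvPolynomial.X I, MvPolynomial.isHomogeneous_X ℂ I, rfl⟩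

lemma minor_isHomogeneous (p N : ℕ) (I : PluckerIndex p N) :
    (minor p N I).IsHomogeneous (p + 1) := by
  unfold minor
  rw [Matrix.det_apply]
  refine MvPolynomial.IsHomogeneous.sum _ _ _ fun σ _ => ?_
  have h : (∏ i : Fin (p + 1), (Matrix.of fun i j : Fin (p + 1) =>
      (MvPolynomial.X (i, I j) : MvPolynomial (Fin (p + 1) × Fin (N + 1)) ℂ))
        (σ i) i).IsHomogeneous (∑ _i : Fin (p + 1), 1) :=
    MvPolynomial.IsHomogeneous.prod _ _ _ fun i _ => MvPolynomial.isHomogeneous_X ℂ _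
  simp only [Finset.sum_const, Finset.card_univ, Fintype.card_fin, smul_eq_mul, mul_one] at h
  rcases Int.units_eq_one_or (Equiv.Perm.sign σ) with hs | hs
  · simpa [hs] using h
  · simpa [hs] using h.neg

lemma val_mem_of_mem_pluckerGrading (p N k : ℕ) {r : PluckerRing p N}
    (hr : r ∈ pluckerGrading p N k) :
    (r : MvPolynomial (Fin (p + 1) × Fin (N + 1)) ℂ).IsHomogeneous ((p + 1) * k) := by
  obtain ⟨P, hP, rfl⟩ := hr
  exact MvPolynomial.IsHomogeneous.aeval (hφ := hP) _ (minor_isHomogeneous p N)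

lemma pluckerGrading_isInternal (p N : ℕ) : DirectSum.IsInternal (pluckerGrading p N) := by
  rw [DirectSum.isInternal_submodule_iff_iSupIndep_and_iSup_eq_top]
  constructor
  · have h1 : iSupIndep (fun k : ℕ => MvPolynomial.homogeneousSubmodule
        (Fin (p + 1) × Fin (N + 1)) ℂ ((p + 1) * k)) :=
      (@DirectSum.Decomposition.isInternal _ _ _ _ _ _ _ (MvPolynomial.homogeneousSubmodule
        (Fin (p + 1) × Fin (N + 1)) ℂ)
        MvPolynomial.gradedAlgebra.toDecomposition).submodule_iSupIndep.comp
        (fun a b h => Nat.eq_of_mul_eq_mul_left (Nat.succ_pos p) h)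
    rw [iSupIndep_def] at h1 ⊢
    intro k
    rw [Submodule.disjoint_def]
    intro x hx hx'
    have h2 := Submodule.disjoint_def.mp (h1 k) (x : MvPolynomial _ ℂ)
      (val_mem_of_mem_pluckerGrading p N k hx) ?_
    · exact Subtype.ext h2
    · have h3 := Submodule.mem_map_of_mem (f := (pluckerMap p N).range.val.toLinearMap) hx'
      simp only [Submodule.map_iSup] at h3
      refine SetLike.le_def.mp (iSup₂_mono fun j _ => ?_) h3
      rintro _ ⟨y, hy, rfl⟩
      exact val_mem_of_mem_pluckerGrading p N j hy
  · rw [eq_top_iff]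
    rintro ⟨_, P, rfl⟩ -
    have h : (pluckerMap p N).rangeRestrict P ∈ ⨆ k, pluckerGrading p N k := by
      rw [← MvPolynomial.sum_homogeneousComponent P, map_sum]
      refine Submodule.sum_mem _ fun i _ => ?_
      exact Submodule.mem_iSup_of_mem i
        ⟨_, MvPolynomial.homogeneousComponent_isHomogeneous i P, rfl⟩
    exact h

instance instGradedAlgebra (p N : ℕ) : GradedAlgebra (pluckerGrading p N) where
  one_mem := ⟨1, MvPolynomial.isHomogeneous_one _ _,
    map_one (pluckerMap p N).rangeRestrict⟩
  mul_mem := by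
    rintro i j _ _ ⟨P, hP, rfl⟩ ⟨Q, hQ, rfl⟩
    exact ⟨P * Q, MvPolynomial.IsHomogeneous.mul hP hQ, map_mul (pluckerMap p N).rangeRestrict _ _⟩
  __ := (pluckerGrading_isInternal p N).chooseDecomposition

/-- The Grassmannian `G(p, N)` of `p`-dimensional linear subspaces of `ℙ^N` over `ℂ`,
as the projective variety cut out by all relations between Plücker coordinates. -/
abbrev Grassmannian (p N : ℕ) : Scheme.{0} := Proj (pluckerGrading p N)

/-- The structure morphism `G(p, N) ⟶ Spec ℂ`. -/
def Grassmannian.toSpec (p N : ℕ) : Grassmannian p N ⟶ Spec (.of ℂ) :=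
  Proj.toSpecZero (pluckerGrading p N) ≫
    Spec.map (CommRingCat.ofHom (algebraMap ℂ (pluckerGrading p N 0)))

/-! ### Line bundles, sections, and their common zero schemes -/

/-- Restriction of regular functions to a smaller open set. -/
def res {X : Scheme.{0}} {U V : X.Opens} (h : V ≤ U) : Γ(X, U) →+* Γ(X, V) :=
  (X.presheaf.map (homOfLE h).op).hom

lemma res_res {X : Scheme.{0}} {U V W : X.Opens} (h : V ≤ U) (h' : W ≤ V) (a : Γ(X, U)) :
    res h' (res h a) = res (h'.trans h) a := by
  simp only [res, ← RingHom.comp_apply, ← CommRingCat.hom_comp, ← Functor.map_comp]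
  rfl

lemma res_app {X Y : Scheme.{0}} (f : X ⟶ Y) {U V : Y.Opens} (h : V ≤ U) (a : Γ(Y, U)) :
    res ((TopologicalSpace.Opens.map f.base).monotone h) ((f.app U).hom a) =
      (f.app V).hom (res h a) := by
  have := congr($(f.naturality (homOfLE h).op) a)
  exact this.symm

/-- A line bundle on `X`, given by an open cover over which it is trivialized and by its
transition functions (which are units by the cocycle condition). -/
structure LineBundle (X : Scheme.{0}) where
  ι : Type
  U : ι → X.Opens
  cover : ⨆ i, U i = ⊤
  g : ∀ i j, Γ(X, U i ⊓ U j)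
  g_self : ∀ i, g i i = 1
  cocycle : ∀ i j k,
    res (V := U i ⊓ U j ⊓ U k) inf_le_left (g i j) *
      res (V := U i ⊓ U j ⊓ U k) (inf_le_inf_right _ inf_le_right) (g j k) =
      res (V := U i ⊓ U j ⊓ U k) (inf_le_inf_right _ inf_le_left) (g i k)

namespace LineBundle

/-- The pullback of a line bundle. -/
def pullback {X Y : Scheme.{0}} (f : X ⟶ Y) (L : LineBundle Y) : LineBundle X where
  ι := L.ι
  U i := f ⁻¹ᵁ L.U i
  cover := by rw [← Scheme.Hom.preimage_iSup, L.cover]; rfl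
  g i j := (f.app (L.U i ⊓ L.U j)).hom (L.g i j)
  g_self i := by rw [L.g_self, map_one]; rfl
  cocycle i j k := by
    have h := congr((f.app (L.U i ⊓ L.U j ⊓ L.U k)).hom $(L.cocycle i j k))
    rw [map_mul, ← res_app, ← res_app, ← res_app] at h
    exact h

/-- The tensor product of two line bundles. -/
def tensor {X : Scheme.{0}} (L M : LineBundle X) : LineBundle X where
  ι := L.ι × M.ι
  U i := L.U i.1 ⊓ M.U i.2
  cover := by
    rw [iSup_prod]
    simp only [← inf_iSup_eq, M.cover, inf_top_eq, L.cover]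
  g i j := res (inf_le_inf inf_le_left inf_le_left) (L.g i.1 j.1) *
    res (inf_le_inf inf_le_right inf_le_right) (M.g i.2 j.2)
  g_self i := by simp only [L.g_self, M.g_self, map_one, mul_one]
  cocycle i j k := by
    have hL := congr(res (V := L.U i.1 ⊓ M.U i.2 ⊓ (L.U j.1 ⊓ M.U j.2) ⊓ (L.U k.1 ⊓ M.U k.2))
      (inf_le_inf (inf_le_inf inf_le_left inf_le_left) inf_le_left) $(L.cocycle i.1 j.1 k.1))
    have hM := congr(res (V := L.U i.1 ⊓ M.U i.2 ⊓ (L.U j.1 ⊓ M.U j.2) ⊓ (L.U k.1 ⊓ M.U k.2))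
      (inf_le_inf (inf_le_inf inf_le_right inf_le_right) inf_le_right) $(M.cocycle i.2 j.2 k.2))
    simp only [map_mul, res_res] at hL hM ⊢
    rw [← hL, ← hM]
    ring

/-- The `n`-th tensor power of a line bundle. -/
def pow {X : Scheme.{0}} (L : LineBundle X) (n : ℕ) : LineBundle X where
  ι := L.ι
  U := L.U
  cover := L.cover
  g i j := L.g i j ^ n
  g_self i := by rw [L.g_self, one_pow]
  cocycle i j k := by
    have h := congr($(L.cocycle i j k) ^ n)
    simpa only [mul_pow, map_pow] using h

/-- A global section of a line bundle: local functions `s i` on the trivializing open sets with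
`s i = g i j * s j` on overlaps. -/
structure GlobalSection {X : Scheme.{0}} (L : LineBundle X) where
  s : ∀ i, Γ(X, L.U i)
  compat : ∀ i j, res (V := L.U i ⊓ L.U j) inf_le_left (s i) =
    L.g i j * res (V := L.U i ⊓ L.U j) inf_le_right (s j)

end LineBundle

/-- `h : H ⟶ X` is (the inclusion of) the scheme-theoretic intersection of the zero divisors of
the sections `σ m` of the line bundles `M m`: it is a closed immersion, and on every affine open
set `V` on which all `M m` are trivialized, its ideal is generated by the local functions that
represent the `σ m`. -/
structure IsCommonZeroScheme {X H : Scheme.{0}} {c : ℕ} {M : Fin c → LineBundle X}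
    (σ : ∀ m, (M m).GlobalSection) (h : H ⟶ X) : Prop where
  isClosedImmersion : IsClosedImmersion h
  ideal_eq : ∀ (V : X.affineOpens) (i : ∀ m, (M m).ι) (hV : ∀ m, V.1 ≤ (M m).U (i m)),
    h.ker.ideal V = Ideal.span (Set.range fun m => res (hV m) ((σ m).s (i m)))

/-! ### The Plücker line bundle -/

/-- The regular function `x_J / x_I` on the chart `x_I ≠ 0` of the Grassmannian. -/
def ratio (p N : ℕ) (I J : PluckerIndex p N) :
    Γ(Grassmannian p N, Proj.basicOpen (pluckerGrading p N) (coord p N I)) :=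
  (Proj.awayToSection (pluckerGrading p N) (coord p N I)).hom
    (HomogeneousLocalization.Away.mk (pluckerGrading p N) (coord_mem p N I) 1 (coord p N J)
      (by simpa using coord_mem p N J))

lemma iSup_basicOpen_coord (p N : ℕ) :
    ⨆ I, Proj.basicOpen (pluckerGrading p N) (coord p N I) = ⊤ := by
  refine Proj.iSup_basicOpen_eq_top' _ _ (fun I => ⟨1, coord_mem p N I⟩) ?_
  rw [eq_top_iff]
  rintro ⟨_, P, rfl⟩ -
  have h : (pluckerMap p N).rangeRestrict P ∈
      Algebra.adjoin (pluckerGrading p N 0) (Set.range (coord p N)) := by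
    induction P using MvPolynomial.induction_on with
    | C a =>
      have h0 : (pluckerMap p N).rangeRestrict (MvPolynomial.C a) ∈ pluckerGrading p N 0 :=
        ⟨MvPolynomial.C a, MvPolynomial.isHomogeneous_C _ a, rfl⟩
      exact Subalgebra.algebraMap_mem _ (⟨_, h0⟩ : pluckerGrading p N 0)
    | add P Q hP hQ => rw [map_add]; exact add_mem hP hQ
    | mul_X P I hP =>
      rw [map_mul]
      exact mul_mem hP (Algebra.subset_adjoin ⟨I, rfl⟩)
  exact h

lemma res_ratio_val (p N : ℕ) (I J : PluckerIndex p N) {W : (Grassmannian p N).Opens}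
    (h : W ≤ Proj.basicOpen (pluckerGrading p N) (coord p N I)) (x : W) :
    ((res h (ratio p N I J)).val x).val =
      Localization.mk (coord p N J) ⟨coord p N I, h x.2⟩ := by
  have h1 := ProjectiveSpectrum.Proj.awayToSection_apply (𝒜 := pluckerGrading p N) (coord p N I)
    (HomogeneousLocalization.Away.mk (pluckerGrading p N) (coord_mem p N I) 1 (coord p N J)
      (by simpa using coord_mem p N J)) ⟨x.1, h x.2⟩
  refine Eq.trans h1 ?_
  rw [HomogeneousLocalization.Away.val_mk, Localization.mk_eq_mk', IsLocalization.map_mk',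
    Localization.mk_eq_mk']
  congr 1
  ext
  simp

lemma section_ext (p N : ℕ) {W : (Grassmannian p N).Opens} (a b : Γ(Grassmannian p N, W))
    (h : ∀ x : W, (a.val x).val = (b.val x).val) : a = b :=
  Subtype.ext (funext fun x => HomogeneousLocalization.val_injective _ (h x))

lemma one_val (p N : ℕ) {W : (Grassmannian p N).Opens} (x : W) :
    ((1 : Γ(Grassmannian p N, W)).val x).val = 1 :=
  HomogeneousLocalization.val_one

lemma mul_val (p N : ℕ) {W : (Grassmannian p N).Opens} (a b : Γ(Grassmannian p N, W)) (x : W) :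
    ((a * b).val x).val = (a.val x).val * (b.val x).val :=
  HomogeneousLocalization.val_mul _ _

/-- The Plücker line bundle `𝒪_G(1)`: on the chart `x_I ≠ 0` it is trivialized by `x_I`, so the
transition functions are the quotients `x_J / x_I`. -/
def pluckerBundle (p N : ℕ) : LineBundle (Grassmannian p N) where
  ι := PluckerIndex p N
  U I := Proj.basicOpen (pluckerGrading p N) (coord p N I)
  cover := iSup_basicOpen_coord p N
  g I J := res inf_le_left (ratio p N I J)
  g_self I := by
    refine section_ext p N _ _ fun x => ?_
    rw [res_ratio_val]
    rw [one_val, ← Localization.mk_one, Localization.mk_eq_mk_iff, Localization.r_iff_exists]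
    exact ⟨1, by simp⟩
  cocycle I J K := by
    refine section_ext p N _ _ fun x => ?_
    rw [res_res, res_res, res_res, mul_val, res_ratio_val, res_ratio_val, res_ratio_val,
      Localization.mk_mul, Localization.mk_eq_mk_iff, Localization.r_iff_exists]
    refine ⟨1, ?_⟩
    simp only [Submonoid.coe_one, Submonoid.coe_mul, one_mul]
    ring

/-- The product `B × G(p, N)` over `ℂ`, as a scheme. -/
abbrev prodGr {B : Scheme.{0}} (b : B ⟶ Spec (.of ℂ)) (p N : ℕ) : Scheme.{0} :=
  Limits.pullback b (Grassmannian.toSpec p N)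

/-- The projection `B × G(p, N) ⟶ B`. -/
abbrev prodGr.fst {B : Scheme.{0}} (b : B ⟶ Spec (.of ℂ)) (p N : ℕ) : prodGr b p N ⟶ B :=
  Limits.pullback.fst b (Grassmannian.toSpec p N)

/-- The projection `B × G(p, N) ⟶ G(p, N)`. -/
abbrev prodGr.snd {B : Scheme.{0}} (b : B ⟶ Spec (.of ℂ)) (p N : ℕ) :
    prodGr b p N ⟶ Grassmannian p N :=
  Limits.pullback.snd b (Grassmannian.toSpec p N)

/-- The line bundle `𝒪_G(k) ⊗ L` on `B × G(p, N)`, for a line bundle `L` on `B`. -/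
def twist {B : Scheme.{0}} (b : B ⟶ Spec (.of ℂ)) (p N k : ℕ) (L : LineBundle B) :
    LineBundle (prodGr b p N) :=
  (((pluckerBundle p N).pow k).pullback (prodGr.snd b p N)).tensor
    (L.pullback (prodGr.fst b p N))

end GrassTsen

end

noncomputable section

namespace GrassTsen

/-! ### The Jacobian criterion for algebraic independence -/

section Jacobian

open MvPolynomial

/-! The local rings of the smooth curve `B` are valuation rings and `H → B` is proper, so a point of
`H` over the function field `K` of `B` extends to a section (`exists_section_of_point`). It remains
to find a `K`-point of the generic fibre of `H`, and this is Tsen's parameter count, carried out on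
matrices.

Describe a point of the Grassmannian by a `(p+1) × (N+1)` matrix over `K` whose entries have poles
of order at most `d` along a divisor of degree `n`. This gives about `(p+1)(N+1)nd` complex
parameters. A section of `𝒪(k)` over the generic point is a form of degree `(p+1)k` in the matrix
entries (`exists_polynomial`), and its vanishing costs about `(p+1)knd` complex equations. As `∑ k ≤
N`, the surplus of parameters grows with `d`.

A nonzero solution is not enough, since some maximal minor has to be nonzero. The count is therefore
made in the algebra generated by the complex components of the minors and of the forms. Its
transcendence degree is at least the rank of the Jacobian of the minor components at one point. At a
suitable bidiagonal matrix, a direction that kills the derivatives of all minors only recombines the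
rows, with coefficients in `W 0`; hence the corank is at most `(p+1)²n`, independently of `d`. If
the minor components vanished at every point where the form components do, then by the
Nullstellensatz and graded Nakayama the algebra would be integral over the subalgebra generated by
too few elements (`exists_algHom_of_card_lt`).

So some complex point of this algebra kills the form components but not all minor components. It
need not come from a matrix. It extends to a `K`-point of a `K`-algebra containing the minors and
the forms (`exists_zero`), and its values on the minors are the Plücker coordinates of a `K`-point
of the Grassmannian at which all sections vanish (`exists_point`). -/

lemma pderiv_aeval {k σ β : Type*} [CommRing k] [Fintype β]
    (f : β → MvPolynomial σ k) (P : MvPolynomial β k) (i : σ) :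
    pderiv i (aeval f P) = ∑ b, aeval f (pderiv b P) * pderiv i (f b) := by
  classical
  induction P using MvPolynomial.induction_on with
  | C a => simp [MvPolynomial.algebraMap_eq]
  | add p q hp hq => simp only [map_add, hp, hq, add_mul, Finset.sum_add_distrib]
  | mul_X p b hp =>
    simp only [map_mul, aeval_X, pderiv_mul, hp, pderiv_X, map_add, add_mul,
      Finset.sum_add_distrib, Finset.sum_mul, Pi.single_apply]
    congr 1
    · exact Finset.sum_congr rfl fun c _ => by ring
    · rw [Finset.sum_eq_single b]
      · simp
      · intro c _ hc
        simp [Ne.symm hc]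
      · simp

/-- If the gradients of `f` at some point are linearly independent, then `f` is algebraically
independent. -/
theorem algebraicIndependent_of_linearIndependent_gradient {k σ β : Type*} [Field k] [CharZero k]
    [Fintype σ] [Fintype β] (f : β → MvPolynomial σ k) (a : σ → k)
    (h : LinearIndependent k fun b i => eval a (pderiv i (f b))) :
    AlgebraicIndependent k f := by
  classical
  obtain ⟨W, hW⟩ : ∃ W : Matrix σ β k,
      (Matrix.of fun b i => eval a (pderiv i (f b))) * W = 1 := by
    rw [← Matrix.mulVec_surjective_iff_exists_right_inverse]
    have h1 := LinearIndependent.rank_matrix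
      (M := Matrix.of fun b i => eval a (pderiv i (f b))) h
    have h2 : LinearMap.range (Matrix.of fun b i => eval a (pderiv i (f b))).mulVecLin = ⊤ :=
      Submodule.eq_top_of_finrank_eq (by rw [← Matrix.rank, h1, Module.finrank_fintype_fun_eq_card])
    exact LinearMap.range_eq_top.mp h2
  -- The Jacobian matrix times the constant matrix `W` evaluates to the identity at `a`, so its
  -- determinant is a nonzero polynomial and the Jacobian has no left kernel.
  have key : ∀ u : β → MvPolynomial σ k, (∀ i, ∑ b, u b * pderiv i (f b) = 0) → u = 0 := by
    intro u hu
    let J : Matrix β σ (MvPolynomial σ k) := Matrix.of fun b i => pderiv i (f b)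
    let W' : Matrix σ β (MvPolynomial σ k) := W.map C
    have h0 : Matrix.vecMul u J = 0 := funext fun i => hu i
    have h1 : Matrix.vecMul u (J * W') = 0 := by
      rw [← Matrix.vecMul_vecMul, h0, Matrix.zero_vecMul]
    have h2 : (J * W').det ≠ 0 := by
      intro hd
      have h3 := congr(eval a $hd)
      rw [RingHom.map_det, RingHom.mapMatrix_apply, Matrix.map_mul] at h3
      have h4 : W'.map (eval a) = W := by ext; simp [W']
      have h5 : J.map (eval a) = Matrix.of fun b i => eval a (pderiv i (f b)) := by
        ext; simp [J]
      rw [h4, h5, hW] at h3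
      simp at h3
    exact Matrix.eq_zero_of_vecMul_eq_zero h2 h1
  -- If `P(f) = 0`, the chain rule and `key` give `(∂P/∂b)(f) = 0` for every `b`. By induction on
  -- the degree all partial derivatives of `P` vanish, and in characteristic zero `P` is constant.
  have main : ∀ (n : ℕ) (P : MvPolynomial β k), P.totalDegree ≤ n → aeval f P = 0 → P = 0 := by
    intro n
    induction n with
    | zero =>
      intro P hP h0
      rw [Nat.le_zero, totalDegree_eq_zero_iff_eq_C] at hP
      rw [hP] at h0 ⊢
      simpa [MvPolynomial.algebraMap_eq] using h0
    | succ n ih =>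
      intro P hP h0
      have h1 : ∀ b, pderiv b P = 0 := by
        have h2 := key (fun b => aeval f (pderiv b P)) fun i => by
          rw [← pderiv_aeval, h0, map_zero]
        intro b
        refine ih _ ?_ (congr_fun h2 b)
        refine Finset.sup_le fun m hm => ?_
        have h3 : m + Finsupp.single b 1 ∈ P.support := by
          rw [mem_support_iff] at hm ⊢
          rw [coeff_pderiv] at hm
          exact left_ne_zero_of_mul hm
        have h4 := (le_totalDegree h3).trans hP
        rw [Finsupp.sum_add_index' (by simp) (by simp)] at h4
        simpa using h4
      have h2 : P = C (coeff 0 P) := by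
        ext m
        rw [coeff_C]
        split_ifs with hm
        · rw [hm]
        · obtain ⟨b, hb⟩ : ∃ b, m b ≠ 0 := by
            by_contra! hc
            exact hm (Finsupp.ext fun b => (hc b).symm)
          have h3 := congr(coeff (m - Finsupp.single b 1) $(h1 b))
          rw [coeff_pderiv, tsub_add_cancel_of_le
            (by simpa using Nat.one_le_iff_ne_zero.mpr hb)] at h3
          simpa [Nat.cast_add_one_ne_zero] using h3
      rw [h2] at h0 ⊢
      simpa [MvPolynomial.algebraMap_eq] using h0
  exact algebraicIndependent_iff.mpr fun P hP => main _ P le_rfl hP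

/-- A family of polynomials contains as many algebraically independent members as the rank of
its Jacobian matrix at any given point. -/
theorem exists_algebraicIndependent_of_finrank {k σ α : Type*} [Field k] [CharZero k]
    [Fintype σ] (g : α → MvPolynomial σ k) (a : σ → k) (V : Submodule k (σ → k))
    (hV : ∀ v : σ → k, (∀ c, ∑ i, v i * eval a (pderiv i (g c)) = 0) → v ∈ V) :
    ∃ (n : ℕ) (c : Fin n → α), Fintype.card σ ≤ n + Module.finrank k V ∧
      AlgebraicIndependent k (g ∘ c) := by
  classical
  let r : α → (σ → k) := fun c i => eval a (pderiv i (g c))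
  obtain ⟨f, hf, hspan, hli⟩ := Submodule.exists_fun_fin_finrank_span_eq k (Set.range r)
  choose c hc using hf
  refine ⟨_, c, ?_, algebraicIndependent_of_linearIndependent_gradient _ a ?_⟩
  · let U := Submodule.span k (Set.range r)
    let D : (σ → k) →ₗ[k] Module.Dual k U :=
      (Submodule.dualRestrict U).comp (Module.piEquiv σ k k).toLinearMap
    -- The kernel of `D` is the annihilator of the span of the gradients, so the rank of the
    -- gradients is at least `card σ - dim V`.
    have hker : LinearMap.ker D ≤ V := by
      intro v hv
      refine hV v fun c => ?_
      have h1 := congr($(LinearMap.mem_ker.mp hv) ⟨r c, Submodule.subset_span ⟨c, rfl⟩⟩)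
      simpa [D, Submodule.dualRestrict_apply, Module.piEquiv_apply_apply, r, mul_comm] using h1
    have h1 := LinearMap.finrank_range_add_finrank_ker D
    have h2 := Submodule.finrank_mono hker
    have h3 : Module.finrank k (LinearMap.range D) ≤ Module.finrank k U :=
      (Submodule.finrank_le _).trans (Subspace.dual_finrank_eq).le
    rw [Module.finrank_fintype_fun_eq_card] at h1
    change _ ≤ Module.finrank k U + _
    omega
  · have h1 : f = fun b => r (c b) := funext fun b => (hc b).symm
    rw [h1] at hli
    exact hli

end Jacobian

/-! ### Intersecting a graded algebra with few hypersurfaces -/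

section GradedCut

open MvPolynomial

/-- Weak Nullstellensatz: if every point of a finitely generated algebra at which the functions
in `s` vanish is a zero of `x`, then `x` lies in the radical of the ideal generated by `s`. -/
lemma mem_radical_span_of_forall_algHom {k R : Type*} [Field k] [IsAlgClosed k] [CommRing R]
    [Algebra k R] [Algebra.FiniteType k R] (s : Set R) (x : R)
    (h : ∀ φ : R →ₐ[k] k, (∀ y ∈ s, φ y = 0) → φ x = 0) : x ∈ (Ideal.span s).radical := by
  have : IsJacobsonRing R := isJacobsonRing_of_finiteType (A := k)
  rw [Ideal.radical_eq_jacobson, Ideal.jacobson, Submodule.mem_sInf]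
  rintro (M : Ideal R) ⟨hM, hmax⟩
  have hmax' : M.IsMaximal := hmax
  let := Ideal.Quotient.field M
  -- Zariski's lemma: the residue field is finite over `k`, hence equal to `k`, so every maximal
  -- ideal is the kernel of a `k`-point.
  have : Module.Finite k (R ⧸ M) := finite_of_finite_type_of_isJacobsonRing k (R ⧸ M)
  have hb : Function.Bijective (algebraMap k (R ⧸ M)) :=
    IsAlgClosed.algebraMap_bijective_of_isIntegral
  let e : k ≃ₐ[k] R ⧸ M := AlgEquiv.ofBijective (Algebra.ofId k (R ⧸ M)) hb
  have h1 := h (e.symm.toAlgHom.comp (Ideal.Quotient.mkₐ k M)) fun y hy => by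
    have h2 : Ideal.Quotient.mk M y = 0 := Ideal.Quotient.eq_zero_iff_mem.mpr
      (hM (Ideal.subset_span hy))
    simp [h2]
  have h3 : e.symm (Ideal.Quotient.mk M x) = 0 := h1
  rw [map_eq_zero_iff _ e.symm.injective] at h3
  exact Ideal.Quotient.eq_zero_iff_mem.mp h3

lemma homogeneousComponent_mul_of_isHomogeneous {k σ : Type*} [CommRing k]
    {f : MvPolynomial σ k} {e : ℕ} (hf : f.IsHomogeneous e) (r : MvPolynomial σ k) (n : ℕ) :
    homogeneousComponent n (f * r) = if e ≤ n then f * homogeneousComponent (n - e) r else 0 := by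
  classical
  conv_lhs => rw [← sum_homogeneousComponent r, Finset.mul_sum, map_sum]
  have h1 : ∀ i, homogeneousComponent n (f * homogeneousComponent i r) =
      if i + e = n then f * homogeneousComponent i r else 0 := fun i => by
    have h2 : (f * homogeneousComponent i r).IsHomogeneous (i + e) := by
      rw [mul_comm]
      exact (homogeneousComponent_isHomogeneous i r).mul hf
    rw [homogeneousComponent_of_mem h2]
    simp only [eq_comm]
  simp only [h1]
  split_ifs with he
  · rw [Finset.sum_eq_single (n - e)]
    · rw [if_pos (by omega)]
    · intro i _ hi
      rw [if_neg (by omega)]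
    · intro hn
      rw [if_pos (by omega), homogeneousComponent_eq_zero _ _ (by simp at hn; omega), mul_zero]
  · exact Finset.sum_eq_zero fun i _ => if_neg (by omega)

variable {k σ γ : Type*} [Field k] [Fintype γ]

lemma isHomogeneous_aeval_of_isWeightedHomogeneous {h : γ → MvPolynomial σ k} {D : γ → ℕ}
    (hh : ∀ c, (h c).IsHomogeneous (D c)) {P : MvPolynomial γ k} {n : ℕ}
    (hP : IsWeightedHomogeneous D P n) : (aeval h P).IsHomogeneous n := by
  classical
  rw [aeval_def, eval₂_eq']
  refine IsHomogeneous.sum _ _ _ fun m hm => ?_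
  rw [← zero_add n]
  refine IsHomogeneous.mul (isHomogeneous_C _ _) ?_
  have h1 := hP (mem_support_iff.mp hm)
  rw [← h1, Finsupp.weight_apply, Finsupp.sum_fintype _ _ (by simp)]
  refine IsHomogeneous.prod _ _ _ fun c _ => ?_
  rw [smul_eq_mul, mul_comm]
  exact (hh c).pow _

lemma homogeneousComponent_aeval {h : γ → MvPolynomial σ k} {D : γ → ℕ}
    (hh : ∀ c, (h c).IsHomogeneous (D c)) (P : MvPolynomial γ k) (n : ℕ) :
    homogeneousComponent n (aeval h P) = aeval h (weightedHomogeneousComponent D n P) := by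
  classical
  induction P using MvPolynomial.induction_on' with
  | monomial m a =>
    have h1 := isWeightedHomogeneous_monomial D m a rfl
    rw [homogeneousComponent_of_mem (isHomogeneous_aeval_of_isWeightedHomogeneous hh h1),
      weightedHomogeneousComponent_of_mem h1]
    split_ifs <;> simp
  | add p q hp hq => simp only [map_add, hp, hq]

/-- Graded Nakayama: if the homogeneous generators `h c`, of positive degrees, of a graded algebra
are nilpotent modulo the ideal generated by the homogeneous elements `f b`, then the algebra is
integral over the subalgebra generated by the `f b`. -/
theorem isIntegral_adjoin_of_pow_mem {β : Type*} [Fintype β]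
    (h : γ → MvPolynomial σ k) (D : γ → ℕ) (hh : ∀ c, (h c).IsHomogeneous (D c))
    (f : β → Algebra.adjoin k (Set.range h)) (e : β → ℕ) (he : ∀ b, 0 < e b)
    (hf : ∀ b, (f b : MvPolynomial σ k).IsHomogeneous (e b))
    (hpow : ∀ c, (⟨h c, Algebra.subset_adjoin ⟨c, rfl⟩⟩ : Algebra.adjoin k (Set.range h)) ∈
      (Ideal.span (Set.range f)).radical) :
    Algebra.IsIntegral (Algebra.adjoin k (Set.range f)) (Algebra.adjoin k (Set.range h)) := by
  classical
  let R := Algebra.adjoin k (Set.range h)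
  let A₀ := Algebra.adjoin k (Set.range f)
  let H : γ → R := fun c => ⟨h c, Algebra.subset_adjoin ⟨c, rfl⟩⟩
  have hval : ∀ P, ((aeval H P : R) : MvPolynomial σ k) = aeval h P := fun P => by
    have h1 : (R.val.comp (aeval H)) = aeval h := by ext c; simp [H]
    exact congr($h1 P)
  have hsurj : ∀ r : R, ∃ P, aeval H P = r := fun r => by
    have h1 : (r : MvPolynomial σ k) ∈ (aeval (R := k) h).range := by
      rw [← Algebra.adjoin_range_eq_range_aeval]; exact r.2
    obtain ⟨P, hP⟩ := h1
    exact ⟨P, Subtype.ext ((hval P).trans hP)⟩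
  choose N hN using hpow
  let n := ∑ c, N c + 1
  have hn : ∀ c, H c ^ n ∈ Ideal.span (Set.range f) := fun c =>
    Ideal.pow_mem_of_pow_mem _ (hN c)
      ((Finset.single_le_sum (fun _ _ => Nat.zero_le _) (Finset.mem_univ c)).trans
        (Nat.le_succ _))
  let M : Submodule A₀ R := Submodule.span A₀
    (Set.range fun α : γ → Fin n => ∏ c, H c ^ (α c : ℕ))
  have hMfg : M.FG := Submodule.fg_span (Set.finite_range _)
  -- Strong induction on the weighted degree. Monomials with all exponents below `n` span `M`; any
  -- other monomial is divisible by some `H c ^ n` and so lies in the ideal of the `f b`.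
  have main : ∀ (δ : ℕ) (P : MvPolynomial γ k), IsWeightedHomogeneous D P δ → aeval H P ∈ M := by
    intro δ
    induction δ using Nat.strong_induction_on with
    | _ δ ih =>
    intro P hP
    suffices hm : ∀ m : γ →₀ ℕ, Finsupp.weight D m = δ → aeval H (monomial m (1 : k)) ∈ M by
      rw [aeval_def, eval₂_eq']
      refine Submodule.sum_mem _ fun m hms => ?_
      have h1 := hm m (hP (mem_support_iff.mp hms))
      rw [aeval_monomial, map_one, one_mul, Finsupp.prod_fintype _ _ (by simp)] at h1
      exact Submodule.smul_mem M (algebraMap k A₀ (coeff m P)) h1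
    intro m hm
    by_cases hlt : ∀ c, m c < n
    · refine Submodule.subset_span ⟨fun c => ⟨m c, hlt c⟩, ?_⟩
      rw [aeval_monomial, map_one, one_mul, Finsupp.prod_fintype _ _ (by simp)]
    · push Not at hlt
      obtain ⟨c, hc⟩ := hlt
      have h1 : aeval H (monomial m (1 : k)) ∈ Ideal.span (Set.range f) := by
        rw [aeval_monomial, map_one, one_mul, Finsupp.prod_fintype _ _ (by simp),
          ← Finset.mul_prod_erase _ _ (Finset.mem_univ c)]
        exact Ideal.mul_mem_right _ _ (Ideal.pow_mem_of_pow_mem _ (hn c) hc)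
      obtain ⟨r, hr⟩ := (Submodule.mem_span_range_iff_exists_fun R).mp h1
      choose Q hQ using fun b => hsurj (r b)
      -- Only the degree `δ` part of `∑ r b * f b` counts, so each `r b` may be replaced by its
      -- component of degree `δ - e b < δ`, to which the induction hypothesis applies.
      have h2 : aeval H (monomial m (1 : k)) = ∑ b, if e b ≤ δ then
          f b * aeval H (weightedHomogeneousComponent D (δ - e b) (Q b)) else 0 := by
        apply Subtype.ext
        have h3 : homogeneousComponent δ (aeval h (monomial m (1 : k))) =
            aeval h (monomial m (1 : k)) := by
          rw [homogeneousComponent_of_mem (isHomogeneous_aeval_of_isWeightedHomogeneous hh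
            (isWeightedHomogeneous_monomial D m 1 hm)), if_pos rfl]
        rw [hval, ← h3, ← hval, ← hr]
        simp only [smul_eq_mul, AddSubmonoidClass.coe_finsetSum, MulMemClass.coe_mul, map_sum]
        refine Finset.sum_congr rfl fun b _ => ?_
        rw [mul_comm, homogeneousComponent_mul_of_isHomogeneous (hf b), ← hQ, hval,
          homogeneousComponent_aeval hh]
        split_ifs
        · rw [← hval]; rfl
        · rfl
      rw [h2]
      refine Submodule.sum_mem _ fun b _ => ?_
      split_ifs with hb
      · exact Submodule.smul_mem M (⟨f b, Algebra.subset_adjoin ⟨b, rfl⟩⟩ : A₀)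
          (ih (δ - e b) (by have := he b; omega) _
            (weightedHomogeneousComponent_mem D _ _))
      · exact M.zero_mem
  have htop : ∀ r : R, r ∈ M := fun r => by
    obtain ⟨P, rfl⟩ := hsurj r
    rw [← finsum_weightedHomogeneousComponent D P,
      finsum_eq_sum _ (weightedHomogeneousComponent_finsupp P), map_sum]
    exact Submodule.sum_mem _ fun i _ =>
      main i _ (weightedHomogeneousComponent_mem D _ _)
  have hfin : Module.Finite A₀ R := ⟨by
    rw [← (eq_top_iff.mpr fun r _ => htop r : M = ⊤)]; exact hMfg⟩
  exact Algebra.IsIntegral.of_finite A₀ R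

/-- Homogeneous equations that are fewer than the number of algebraically independent elements of
a graded algebra have a common zero outside the vertex. -/
theorem exists_algHom_of_card_lt [IsAlgClosed k] [CharZero k] [Fintype σ] {α β : Type*}
    [Fintype α] [Fintype β] (g : α → MvPolynomial σ k) (d : ℕ)
    (hg : ∀ a, (g a).IsHomogeneous d) (f : β → MvPolynomial σ k) (e : β → ℕ) (he : ∀ b, 0 < e b)
    (hf : ∀ b, (f b).IsHomogeneous (e b)) (pt : σ → k) (V : Submodule k (σ → k))
    (hV : ∀ v : σ → k, (∀ c, ∑ i, v i * eval pt (pderiv i (g c)) = 0) → v ∈ V)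
    (hcard : Fintype.card β + Module.finrank k V < Fintype.card σ) :
    ∃ φ : Algebra.adjoin k (Set.range (Sum.elim g f)) →ₐ[k] k,
      (∀ b, φ ⟨f b, Algebra.subset_adjoin ⟨Sum.inr b, rfl⟩⟩ = 0) ∧
      ∃ a, φ ⟨g a, Algebra.subset_adjoin ⟨Sum.inl a, rfl⟩⟩ ≠ 0 := by
  classical
  by_contra! hcon
  let R := Algebra.adjoin k (Set.range (Sum.elim g f))
  let F : β → R := fun b => ⟨f b, Algebra.subset_adjoin ⟨Sum.inr b, rfl⟩⟩
  have : Algebra.FiniteType k R :=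
    (Subalgebra.fg_iff_finiteType _).mp ⟨(Set.finite_range (Sum.elim g f)).toFinset,
      by rw [Set.Finite.coe_toFinset]⟩
  have hint := isIntegral_adjoin_of_pow_mem (Sum.elim g f) (Sum.elim (fun _ => d) e)
    (by rintro (a | b); exacts [hg a, hf b]) F e he hf (by
      intro c
      apply mem_radical_span_of_forall_algHom (k := k)
      intro φ hφ
      have hφ' : ∀ b, φ (F b) = 0 := fun b => hφ _ ⟨b, rfl⟩
      rcases c with a | b
      · exact hcon φ hφ' a
      · exact hφ' b)
  -- Integrality bounds the transcendence degree of `R` by `card β`, while the Jacobian at `pt`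
  -- provides at least `card σ - dim V` independent elements.
  have halg : Algebra.IsAlgebraic (Algebra.adjoin k (Set.range F)) R :=
    Algebra.IsIntegral.isAlgebraic
  have htr := Algebra.IsAlgebraic.trdeg_le_cardinalMk k (A := R) (Set.range F)
  obtain ⟨n, c, hn, hind⟩ := exists_algebraicIndependent_of_finrank g pt V hV
  have hG : AlgebraicIndependent k
      (fun i => ⟨g (c i), Algebra.subset_adjoin ⟨Sum.inl (c i), rfl⟩⟩ : Fin n → R) :=
    AlgebraicIndependent.of_comp R.val hind
  have h1 := hG.lift_cardinalMk_le_trdeg.trans (Cardinal.lift_le.mpr htr)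
  have h2 : Cardinal.mk (Set.range F) ≤ (Fintype.card β : ℕ) := by
    rw [← Nat.card_eq_fintype_card (α := β)]
    have h3 : Cardinal.mk (Set.range F) = (Nat.card (Set.range F) : ℕ) :=
      (Nat.cast_card (α := Set.range F)).symm
    rw [h3, Nat.cast_le]
    exact Finite.card_range_le F
  have h3 := h1.trans (Cardinal.lift_le.mpr h2)
  simp only [Cardinal.mk_fin, Cardinal.lift_natCast, Nat.cast_le] at h3
  omega

end GradedCut

/-! ### Derivatives of minors -/

section Minors

lemma derivation_prod {R A ι : Type*} [CommRing R] [CommRing A] [Algebra R A] [DecidableEq ι]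
    (D : Derivation R A A) (f : ι → A) (s : Finset ι) :
    D (∏ i ∈ s, f i) = ∑ j ∈ s, ∏ i ∈ s, Function.update f j (D (f j)) i := by
  induction s using Finset.induction_on with
  | empty => simp
  | insert a s ha ih =>
    rw [Finset.prod_insert ha, Derivation.leibniz, ih, Finset.sum_insert ha, smul_eq_mul,
      smul_eq_mul, Finset.prod_insert ha, Function.update_self, add_comm, mul_comm (∏ i ∈ s, f i),
      Finset.mul_sum]
    congr 1
    · congr 1
      refine Finset.prod_congr rfl fun i hi => ?_
      rw [Function.update_of_ne (ne_of_mem_of_not_mem hi ha)]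
    · refine Finset.sum_congr rfl fun j hj => ?_
      rw [Finset.prod_insert ha, Function.update_of_ne (ne_of_mem_of_not_mem hj ha).symm]

lemma derivation_det {R A n : Type*} [CommRing R] [CommRing A] [Algebra R A] [DecidableEq n]
    [Fintype n] (D : Derivation R A A) (M : Matrix n n A) :
    D M.det = ∑ j, (M.updateRow j fun i => D (M j i)).det := by
  simp only [Matrix.det_apply, map_sum]
  rw [Finset.sum_comm]
  refine Finset.sum_congr rfl fun τ _ => ?_
  have h1 : D (Equiv.Perm.sign τ • ∏ i, M (τ i) i) = Equiv.Perm.sign τ • D (∏ i, M (τ i) i) := by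
    rcases Int.units_eq_one_or (Equiv.Perm.sign τ) with h | h <;> simp [h]
  rw [h1, ← Finset.smul_sum, derivation_prod]
  congr 1
  rw [← Equiv.sum_comp τ (fun j => ∏ i, M.updateRow j (fun i => D (M j i)) (τ i) i)]
  refine Finset.sum_congr rfl fun j _ => Finset.prod_congr rfl fun i _ => ?_
  by_cases h : i = j
  · subst h
    rw [Function.update_self, Matrix.updateRow_self]
  · rw [Function.update_of_ne h, Matrix.updateRow_ne (by simpa using h)]

/-- The expansion of the determinant of a product of rectangular matrices. -/
lemma det_mul_eq_sum_submatrix {R m n : Type*} [CommRing R] [DecidableEq n] [Fintype n]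
    [Fintype m] [DecidableEq m] (M : Matrix n m R) (L : Matrix m n R) :
    (M * L).det = ∑ g : n → m, (∏ b, L (g b) b) * (M.submatrix id g).det := by
  rw [← Matrix.det_transpose]
  have h1 : (M * L).transpose = fun b => ∑ c, L c b • fun a => M a c := by
    ext b a
    simp [Matrix.mul_apply, Finset.sum_apply, mul_comm]
  have h2 := (Matrix.detRowAlternating (n := n) (R := R)).toMultilinearMap.map_sum
    (fun b c => L c b • fun a => M a c)
  rw [h1]
  refine h2.trans (Finset.sum_congr rfl fun g _ => ?_)
  have h3 := (Matrix.detRowAlternating (n := n) (R := R)).toMultilinearMap.map_smul_univ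
    (fun b => L (g b) b) (fun b a => M a (g b))
  refine h3.trans ?_
  rw [smul_eq_mul, ← Matrix.det_transpose (M.submatrix id g)]
  rfl

/-- A linear relation between the maximal minors of several matrices holds for all column
selections as soon as it holds for increasing ones. -/
lemma sum_det_submatrix_eq_zero {R ι : Type*} [CommRing R] [Fintype ι] {p N : ℕ}
    (M : ι → Matrix (Fin (p + 1)) (Fin (N + 1)) R)
    (h : ∀ I : PluckerIndex p N, ∑ j, ((M j).submatrix id I).det = 0)
    (g : Fin (p + 1) → Fin (N + 1)) : ∑ j, ((M j).submatrix id g).det = 0 := by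
  classical
  by_cases hg : Function.Injective g
  · let s := Finset.univ.image g
    have hs : s.card = p + 1 := by
      rw [Finset.card_image_of_injective _ hg, Finset.card_univ, Fintype.card_fin]
    let I : PluckerIndex p N := s.orderEmbOfFin hs
    have hI : ∀ b, ∃ a, I a = g b := fun b => by
      have h1 : g b ∈ Set.range I := by
        rw [Finset.range_orderEmbOfFin]; simp [s]
      exact h1
    choose τ hτ using hI
    have hτi : Function.Injective τ := fun a b hab => hg (by rw [← hτ, ← hτ, hab])
    let e := Equiv.ofBijective τ (Finite.injective_iff_bijective.mp hτi)
    have h1 : ∀ j, ((M j).submatrix id g).det =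
        Equiv.Perm.sign e * ((M j).submatrix id I).det := fun j => by
      rw [← Matrix.det_permute']
      congr 1
      ext a b
      simp [e, hτ]
    simp only [h1, ← Finset.mul_sum, h I, mul_zero]
  · rw [Function.Injective] at hg
    push Not at hg
    obtain ⟨a, b, hab, hne⟩ := hg
    exact Finset.sum_eq_zero fun j _ => Matrix.det_zero_of_column_eq hne fun i => by simp [hab]

/-- If, at linearly independent vectors `v`, the derivative of every maximal minor in the direction
`u` vanishes, then every `u i` lies in the span of `v`. -/
theorem mem_span_of_sum_det_updateRow_eq_zero {K : Type*} [Field K] {p N : ℕ}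
    (v u : Matrix (Fin (p + 1)) (Fin (N + 1)) K) (hv : LinearIndependent K v.row)
    (h : ∀ I : PluckerIndex p N, ∑ j, ((v.updateRow j (u j)).submatrix id I).det = 0)
    (i : Fin (p + 1)) : u i ∈ Submodule.span K (Set.range v.row) := by
  classical
  by_contra hui
  obtain ⟨ℓ, hℓu, hℓ⟩ := Submodule.exists_le_ker_of_notMem hui
  have hℓv : ∀ j, ℓ (v j) = 0 := fun j => hℓ (Submodule.subset_span ⟨j, rfl⟩)
  obtain ⟨W, hW⟩ : ∃ W : Matrix (Fin (N + 1)) (Fin (p + 1)) K, v * W = 1 := by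
    rw [← Matrix.mulVec_surjective_iff_exists_right_inverse]
    have h1 := LinearIndependent.rank_matrix hv
    have h2 : LinearMap.range v.mulVecLin = ⊤ :=
      Submodule.eq_top_of_finrank_eq (by rw [← Matrix.rank, h1, Module.finrank_fintype_fun_eq_card])
    exact LinearMap.range_eq_top.mp h2
  -- A right inverse of `v` with column `i` replaced by the functional `ℓ`, which kills the rows of
  -- `v` but not `u i`. In `v.updateRow j (u j) * L`, row `i` is zero for `j ≠ i`, and for `j = i`
  -- the determinant is `ℓ (u i)`. The sum of these determinants is a combination of the vanishing
  -- sums of minors, which forces `ℓ (u i) = 0`.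
  let L : Matrix (Fin (N + 1)) (Fin (p + 1)) K := W.updateCol i fun c => ℓ (Pi.single c 1)
  have hLi : ∀ w : Fin (N + 1) → K, ∑ c, w c * L c i = ℓ w := fun w => by
    rw [LinearMap.pi_apply_eq_sum_univ ℓ w]
    refine Finset.sum_congr rfl fun c _ => ?_
    have h1 : L c i = ℓ (Pi.single c 1) := Matrix.updateCol_self ..
    have h2 : (Pi.single c 1 : Fin (N + 1) → K) = fun j => if c = j then 1 else 0 := by
      ext j
      simp [Pi.single_apply, eq_comm]
    rw [h1, h2, smul_eq_mul]
  have hLv : ∀ a b, b ≠ i → ∑ c, v a c * L c b = (1 : Matrix _ _ K) a b := fun a b hb => by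
    rw [← hW, Matrix.mul_apply]
    simp [L, Matrix.updateCol_ne hb]
  have h0 : ∑ j, (v.updateRow j (u j) * L).det = 0 := by
    simp only [det_mul_eq_sum_submatrix]
    rw [Finset.sum_comm]
    refine Finset.sum_eq_zero fun g _ => ?_
    rw [← Finset.mul_sum, sum_det_submatrix_eq_zero _ h, mul_zero]
  rw [Finset.sum_eq_single i] at h0
  · have h1 : v.updateRow i (u i) * L = (1 : Matrix _ _ K).updateRow i (Matrix.vecMul (u i) L) := by
      ext a b
      rw [Matrix.mul_apply]
      by_cases ha : a = i
      · subst ha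
        simp [Matrix.vecMul, dotProduct]
      · rw [Matrix.updateRow_ne ha, Matrix.updateRow_ne ha]
        by_cases hb : b = i
        · subst hb
          rw [hLi, hℓv, Matrix.one_apply_ne ha]
        · exact hLv a b hb
    have h2 : Matrix.vecMul (u i) L =
        ∑ b, (Matrix.vecMul (u i) L) b • (1 : Matrix (Fin (p + 1)) (Fin (p + 1)) K) b := by
      ext b
      simp [Finset.sum_apply, Matrix.one_apply]
    rw [h1, h2, Matrix.det_updateRow_sum, Matrix.det_one, smul_eq_mul, mul_one] at h0
    exact hℓu ((hLi (u i)).symm.trans h0)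
  · intro j _ hj
    refine Matrix.det_eq_zero_of_row_eq_zero i fun b => ?_
    rw [Matrix.mul_apply, Matrix.updateRow_ne hj.symm]
    by_cases hb : b = i
    · subst hb
      exact (hLi _).trans (hℓv _)
    · rw [hLv i b hb, Matrix.one_apply_ne (Ne.symm hb)]
  · simp

end Minors

/-! ### Functions with bounded poles on a curve -/

/-- A filtration of a field `K` over `k` by finite-dimensional subspaces `W d` that behaves like the
filtration of a function field in one variable by the order of poles along a divisor of
degree `n`. -/
structure PoleFiltration (k K : Type*) [Field k] [Field K] [Algebra k K] where
  n : ℕ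
  n_pos : 0 < n
  x : K
  W : ℕ → Submodule k K
  monotone_W : Monotone W
  shift : ℕ
  mul_mem : ∀ {a b : ℕ} {y z : K}, y ∈ W a → z ∈ W b → y * z ∈ W (a + b + shift)
  finrank_W : ∀ d, Module.finrank k (W d) = n * (d + 1)
  exists_scale : ∀ s : Finset K, ∃ q ≠ 0, ∃ e, ∀ y ∈ s, q * y ∈ W e
  pow_mul_mem : ∀ {e : ℕ} (d : ℕ) {y : K}, y ∈ W e → x ^ d * y ∈ W (e + d)
  mem_zero : ∀ {e d : ℕ} {y : K}, y ∈ W e → x ^ d * y ∈ W d → y ∈ W 0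

section Existence

open Polynomial

variable {k : Type*} [Field k] {A : Type*} [CommRing A] [IsDomain A] [Algebra k[X] A]
  {K : Type*} [Field K] [Algebra A K] [IsFractionRing A K] [Algebra k K] [Algebra k[X] K]
  [IsScalarTower k k[X] K] [IsScalarTower k[X] A K]

/-- `W d` consists of the combinations of the basis with polynomial coefficients of degree at most
`d`, so its dimension is exactly `n * (d + 1)` and Riemann–Roch is not needed. Multiplication by `X`
raises the degree of a nonzero coefficient by exactly one, which gives `mem_zero`. -/
lemma exists_poleFiltration_of_basis {n : ℕ} (hn : 0 < n) (b : Module.Basis (Fin n) k[X] A) :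
    Nonempty (PoleFiltration k K) := by
  classical
  let β : Fin n → K := fun j => algebraMap A K (b j)
  let Ψ : (Fin n → k[X]) →ₗ[k[X]] K := Fintype.linearCombination k[X] β
  have hΨ : ∀ f, Ψ f = algebraMap A K (b.equivFun.symm f) := fun f => by
    rw [Module.Basis.equivFun_symm_apply, map_sum]
    refine (Fintype.linearCombination_apply k[X] β f).trans (Finset.sum_congr rfl fun j _ => ?_)
    rw [Algebra.smul_def, Algebra.smul_def, map_mul, ← IsScalarTower.algebraMap_apply]
  have hinj : Function.Injective Ψ := fun f g h => by
    rw [hΨ, hΨ] at h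
    exact b.equivFun.symm.injective (IsFractionRing.injective A K h)
  let W : ℕ → Submodule k K := fun d : ℕ =>
    LinearMap.range ((Ψ.restrictScalars k : (Fin n → k[X]) →ₗ[k] K).comp
      (LinearMap.pi fun j : Fin n => (degreeLT k (d + 1)).subtype.comp (LinearMap.proj j)))
  have hW : ∀ {d y}, y ∈ W d ↔ ∃ f : Fin n → k[X], (∀ j, (f j).degree < (d + 1 : ℕ)) ∧
      Ψ f = y := fun {d y} => by
    constructor
    · rintro ⟨f, rfl⟩
      exact ⟨fun j => f j, fun j => mem_degreeLT.mp (f j).2, rfl⟩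
    · rintro ⟨f, hf, rfl⟩
      exact ⟨fun j => ⟨f j, mem_degreeLT.mpr (hf j)⟩, rfl⟩
  have hmono : Monotone W := fun d e hde y hy => by
    obtain ⟨f, hf, rfl⟩ := hW.mp hy
    exact hW.mpr ⟨f, fun j => (hf j).trans_le (by exact_mod_cast Nat.succ_le_succ hde), rfl⟩
  have hex : ∀ a : A, ∃ e, algebraMap A K a ∈ W e := fun a => by
    refine ⟨Finset.univ.sup fun j => (b.equivFun a j).natDegree, hW.mpr ⟨b.equivFun a, fun j => ?_,
      by rw [hΨ, LinearEquiv.symm_apply_apply]⟩⟩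
    refine (degree_le_natDegree).trans_lt ?_
    exact_mod_cast Nat.lt_succ_of_le
      (Finset.le_sup (f := fun j => (b.equivFun a j).natDegree) (Finset.mem_univ j))
  have hpolymul : ∀ (e d : ℕ) (q : k[X]) (y : K), q.degree < (d + 1 : ℕ) → y ∈ W e →
      algebraMap k[X] K q * y ∈ W (e + d) := fun e d q y hq hy => by
    obtain ⟨f, hf, rfl⟩ := hW.mp hy
    refine hW.mpr ⟨q • f, fun j => ?_, by rw [map_smul, Algebra.smul_def]⟩
    rw [Pi.smul_apply, smul_eq_mul]
    have h1 := natDegree_mul_le (p := q) (q := f j)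
    have h2 : q.natDegree < d + 1 := by
      rcases eq_or_ne q 0 with rfl | h0
      · simp
      · exact (natDegree_lt_iff_degree_lt h0).mpr hq
    have h3 : (f j).natDegree < e + 1 := by
      rcases eq_or_ne (f j) 0 with h0 | h0
      · simp [h0]
      · exact (natDegree_lt_iff_degree_lt h0).mpr (hf j)
    refine degree_le_natDegree.trans_lt ?_
    exact_mod_cast (by omega : (q * f j).natDegree < e + d + 1)
  -- The products `b i * b j` have coefficients of bounded degree; this bound is the error term
  -- `shift` in the multiplication rule.
  choose s hs using fun ij : Fin n × Fin n => hex (b ij.1 * b ij.2)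
  let c₀ := Finset.univ.sup s
  refine ⟨⟨n, hn, algebraMap k[X] K X, W, hmono, c₀, ?_, ?_, ?_, ?_, ?_⟩⟩
  · intro d e y z hy hz
    obtain ⟨f, hf, rfl⟩ := hW.mp hy
    obtain ⟨g, hg, rfl⟩ := hW.mp hz
    have h1 : Ψ f * Ψ g = ∑ i, ∑ j, algebraMap k[X] K (f i) *
        (algebraMap k[X] K (g j) * algebraMap A K (b i * b j)) := by
      simp only [Ψ, Fintype.linearCombination_apply, Finset.sum_mul_sum, Algebra.smul_def, β,
        map_mul]
      exact Finset.sum_congr rfl fun i _ => Finset.sum_congr rfl fun j _ => by ring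
    rw [h1]
    refine Submodule.sum_mem _ fun i _ => Submodule.sum_mem _ fun j _ => ?_
    have h2 := hpolymul _ d _ _ (hf i) (hpolymul _ e _ _ (hg j) (hs (i, j)))
    refine hmono ?_ h2
    have h3 : s (i, j) ≤ c₀ := Finset.le_sup (Finset.mem_univ _)
    omega
  · intro d
    refine (LinearMap.finrank_range_of_inj ?_).trans ?_
    · rw [LinearMap.coe_comp]
      exact hinj.comp fun f g h => funext fun j => Subtype.ext (congr_fun h j)
    · rw [Module.finrank_pi_fintype]
      simp [(degreeLTEquiv k (d + 1)).finrank_eq]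
  · intro t
    obtain ⟨q, hq⟩ := IsLocalization.exist_integer_multiples_of_finset (nonZeroDivisors A) t
    refine ⟨algebraMap A K q, IsFractionRing.to_map_ne_zero_of_mem_nonZeroDivisors q.2, ?_⟩
    choose! a ha using hq
    choose e he using hex
    refine ⟨t.sup fun y => e (a y), fun y hy => ?_⟩
    have h1 : algebraMap A K q * y = algebraMap A K (a y) := by
      rw [ha y hy]; exact (Algebra.smul_def _ _).symm
    rw [h1]
    exact hmono (Finset.le_sup (f := fun y => e (a y)) hy) (he _)
  · intro e d y hy
    rw [← map_pow]
    refine hpolymul e d _ y ?_ hy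
    rw [degree_X_pow]
    exact_mod_cast Nat.lt_succ_self d
  · intro e d y hy hxy
    obtain ⟨f, hf, rfl⟩ := hW.mp hy
    obtain ⟨g, hg, hfg⟩ := hW.mp hxy
    refine hW.mpr ⟨f, fun j => ?_, rfl⟩
    rw [← map_pow, ← Algebra.smul_def, ← map_smul] at hfg
    have h1 := congr_fun (hinj hfg) j
    rw [Pi.smul_apply, smul_eq_mul] at h1
    have h2 := hg j
    rcases eq_or_ne (f j) 0 with h0 | h0
    · rw [h0, degree_zero]; exact bot_lt_iff_ne_bot.mpr (by simp)
    · rw [h1, degree_mul, degree_X_pow, degree_eq_natDegree h0] at h2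
      rw [degree_eq_natDegree h0]
      have h3 : d + (f j).natDegree < d + 1 := by exact_mod_cast h2
      exact_mod_cast (by omega : (f j).natDegree < 0 + 1)

end Existence

section FunctionField

open Polynomial

/-- The function field of a curve has a pole filtration. -/
theorem exists_poleFiltration (k K F : Type*) [Field k] [CharZero k] [Field K] [Algebra k K]
    [Algebra k[X] K] [IsScalarTower k k[X] K] [Field F] [Algebra k[X] F] [IsFractionRing k[X] F]
    [Algebra F K] [IsScalarTower k[X] F K] [FiniteDimensional F K] :
    Nonempty (PoleFiltration k K) := by
  have : CharZero k[X] := charZero_of_injective_algebraMap (R := k) C_injective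
  have : CharZero F := charZero_of_injective_algebraMap (IsFractionRing.injective k[X] F)
  -- In characteristic zero the integral closure is finite over `k[X]`; being torsion-free over a
  -- principal ideal domain, it is free.
  let A := integralClosure k[X] K
  have : IsFractionRing A K := integralClosure.isFractionRing_of_finite_extension F K
  have : Module.Finite k[X] A := IsIntegralClosure.finite k[X] F K A
  have hinj : Function.Injective (algebraMap k[X] K) := by
    rw [IsScalarTower.algebraMap_eq k[X] F K]
    exact (algebraMap F K).injective.comp (IsFractionRing.injective k[X] F)
  have : FaithfulSMul k[X] K := (faithfulSMul_iff_algebraMap_injective _ _).mpr hinj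
  have : Module.IsTorsionFree k[X] A := inferInstance
  have : Module.Free k[X] A := inferInstance
  exact exists_poleFiltration_of_basis (A := A) Module.finrank_pos (Module.finBasis k[X] A)

end FunctionField

/-! ### Polynomials with coefficients in a subspace of an extension field -/

section Extension

open MvPolynomial TensorProduct

variable {k K σ : Type*} [Field k] [Field K] [Algebra k K]

/-- The polynomials `∑ u * h` with `u` in the subspace `U` of `K` and `h` a form of degree `δ`
over `k`. -/
def formsOver (σ : Type*) (U : Submodule k K) (δ : ℕ) : Submodule k (MvPolynomial σ K) :=
  Submodule.span k {H | ∃ u ∈ U, ∃ h : MvPolynomial σ k, h.IsHomogeneous δ ∧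
    C u * map (algebraMap k K) h = H}

lemma mul_mem_formsOver {U U' : Submodule k K} {δ δ' : ℕ} {H H' : MvPolynomial σ K}
    (hH : H ∈ formsOver σ U δ) (hH' : H' ∈ formsOver σ U' δ') :
    H * H' ∈ formsOver σ (U * U') (δ + δ') := by
  have h1 : formsOver σ U δ * formsOver σ U' δ' ≤ formsOver σ (U * U') (δ + δ') := by
    rw [formsOver, formsOver, Submodule.span_mul_span, Submodule.span_le]
    rintro _ ⟨_, ⟨u, hu, h, hh, rfl⟩, _, ⟨u', hu', h', hh', rfl⟩, rfl⟩
    refine Submodule.subset_span ⟨u * u', Submodule.mul_mem_mul hu hu', h * h', hh.mul hh', ?_⟩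
    simp only [map_mul]
    ring
  exact h1 (Submodule.mul_mem_mul hH hH')

lemma C_mem_formsOver {U : Submodule k K} {u : K} (hu : u ∈ U) :
    (C u : MvPolynomial σ K) ∈ formsOver σ U 0 :=
  Submodule.subset_span ⟨u, hu, 1, isHomogeneous_one _ _, by simp⟩

lemma formsOver_mono {U U' : Submodule k K} (h : U ≤ U') (δ : ℕ) :
    formsOver σ U δ ≤ formsOver σ U' δ :=
  Submodule.span_mono fun _ ⟨u, hu, hh⟩ => ⟨u, h hu, hh⟩

lemma pow_mem_formsOver {U : Submodule k K} {H : MvPolynomial σ K} (hH : H ∈ formsOver σ U 1)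
    (n : ℕ) : H ^ n ∈ formsOver σ (U ^ n) n := by
  induction n with
  | zero => simpa using C_mem_formsOver (σ := σ) (Submodule.one_le.mp le_rfl : (1 : K) ∈ (1 : Submodule k K))
  | succ n ih => simpa only [pow_succ] using mul_mem_formsOver ih hH

lemma prod_mem_formsOver {ι : Type*} {U : Submodule k K} (s : Finset ι) (a : ι → ℕ)
    (H : ι → MvPolynomial σ K) (hH : ∀ i ∈ s, H i ∈ formsOver σ (U ^ a i) (a i)) :
    ∏ i ∈ s, H i ∈ formsOver σ (U ^ ∑ i ∈ s, a i) (∑ i ∈ s, a i) := by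
  classical
  induction s using Finset.induction_on with
  | empty => simpa using C_mem_formsOver (σ := σ) (Submodule.one_le.mp le_rfl : (1 : K) ∈ (1 : Submodule k K))
  | insert j s hj ih =>
    rw [Finset.prod_insert hj, Finset.sum_insert hj, pow_add]
    exact mul_mem_formsOver (hH j (Finset.mem_insert_self _ _))
      (ih fun i hi => hH i (Finset.mem_insert_of_mem hi))

/-- Trades one form over `K` for `dim U` forms over `k`; this is how equations over the function
field are counted over the base field. -/
lemma exists_eq_sum_of_mem_formsOver {ι : Type*} [Fintype ι] {U : Submodule k K}
    (b : Module.Basis ι k U) {δ : ℕ} {H : MvPolynomial σ K} (hH : H ∈ formsOver σ U δ) :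
    ∃ h : ι → MvPolynomial σ k, (∀ c, (h c).IsHomogeneous δ) ∧
      H = ∑ c, C (b c : K) * map (algebraMap k K) (h c) := by
  induction hH using Submodule.span_induction with
  | mem x hx =>
    obtain ⟨u, hu, h, hh, rfl⟩ := hx
    refine ⟨fun c => C (b.repr ⟨u, hu⟩ c) * h, fun c => hh.C_mul _, ?_⟩
    have h1 := congr(($(b.sum_repr ⟨u, hu⟩) : K))
    conv_lhs => rw [show u = _ from h1.symm]
    rw [AddSubmonoidClass.coe_finsetSum, map_sum, Finset.sum_mul]
    refine Finset.sum_congr rfl fun c _ => ?_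
    simp only [Submodule.coe_smul, Algebra.smul_def, map_mul, map_C]
    ring
  | zero => exact ⟨0, fun c => isHomogeneous_zero _ _ _, by simp⟩
  | add x y _ _ hx hy =>
    obtain ⟨h, hh, rfl⟩ := hx
    obtain ⟨h', hh', rfl⟩ := hy
    refine ⟨h + h', fun c => (hh c).add (hh' c), ?_⟩
    simp only [Pi.add_apply, map_add, mul_add, Finset.sum_add_distrib]
  | smul a x _ hx =>
    obtain ⟨h, hh, rfl⟩ := hx
    refine ⟨fun c => C a * h c, fun c => (hh c).C_mul _, ?_⟩
    rw [Finset.smul_sum]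
    refine Finset.sum_congr rfl fun c _ => ?_
    rw [Algebra.smul_def, IsScalarTower.algebraMap_apply k K (MvPolynomial σ K),
      MvPolynomial.algebraMap_eq, map_mul, map_C]
    ring

/-- Substituting linear forms with coefficients in `U` into a form with coefficients in `U'`. -/
lemma aeval_mem_formsOver {τ : Type*} [Fintype τ] {U U' : Submodule k K} {δ : ℕ}
    {S : τ → MvPolynomial σ K} (hS : ∀ t, S t ∈ formsOver σ U 1) {F : MvPolynomial τ K}
    (hF : F.IsHomogeneous δ) (hF' : ∀ m, coeff m F ∈ U') :
    aeval S F ∈ formsOver σ (U' * U ^ δ) δ := by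
  rw [aeval_def, eval₂_eq']
  refine Submodule.sum_mem _ fun m hm => ?_
  have h1 := hF (mem_support_iff.mp hm)
  rw [Finsupp.weight_apply, Finsupp.sum_fintype _ _ (by simp)] at h1
  simp only [Pi.one_apply, smul_eq_mul, mul_one] at h1
  have h2 := mul_mem_formsOver (C_mem_formsOver (σ := σ) (hF' m))
    (prod_mem_formsOver Finset.univ m (fun t => S t ^ m t) fun t _ => pow_mem_formsOver (hS t) _)
  rw [h1, zero_add] at h2
  exact h2

/-- A `k`-point of a `k`-algebra of polynomials extends to a `K`-point of the `K`-algebra that it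
spans. -/
lemma exists_algHom_extension (R : Subalgebra k (MvPolynomial σ k)) (φ : R →ₐ[k] k) :
    ∃ (Q : Subalgebra K (MvPolynomial σ K)) (Θ : Q →ₐ[K] K), ∀ {ι : Type} [Fintype ι]
      (u : ι → K) (h : ι → R), ∃ hQ : ∑ c, C (u c) * map (algebraMap k K) (h c : MvPolynomial σ k) ∈ Q,
        Θ ⟨_, hQ⟩ = ∑ c, u c * algebraMap k K (φ (h c)) := by
  let i : K ⊗[k] R →ₐ[K] MvPolynomial σ K :=
    (algebraTensorAlgEquiv k K).toAlgHom.comp (Algebra.TensorProduct.map (AlgHom.id K K) R.val)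
  have hi : ∀ (u : K) (r : R), i (u ⊗ₜ r) = C u * map (algebraMap k K) (r : MvPolynomial σ k) :=
    fun u r => by
      simp [i, algebraTensorAlgEquiv_tmul, Algebra.smul_def, MvPolynomial.algebraMap_eq]
  -- By flatness `K ⊗ R` is a subalgebra of the polynomial ring over `K`, so the base change of `φ`
  -- is well defined on its image.
  have hinj : Function.Injective i := by
    refine (algebraTensorAlgEquiv (σ := σ) k K).injective.comp ?_
    exact Module.Flat.lTensor_preserves_injective_linearMap (M := K) R.val.toLinearMap
      Subtype.val_injective
  let Θ₀ : K ⊗[k] R →ₐ[K] K :=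
    Algebra.TensorProduct.lift (AlgHom.id K K) ((Algebra.ofId k K).comp φ) fun _ _ => .all _ _
  let e := AlgEquiv.ofInjective i hinj
  refine ⟨i.range, Θ₀.comp e.symm.toAlgHom, fun u h => ?_⟩
  have h1 : i (∑ c, u c ⊗ₜ h c) = ∑ c, C (u c) * map (algebraMap k K) (h c : MvPolynomial σ k) := by
    simp only [map_sum, hi]
  refine ⟨⟨_, h1⟩, ?_⟩
  have h2 : e.symm ⟨_, ⟨_, h1⟩⟩ = ∑ c, u c ⊗ₜ h c := by
    rw [AlgEquiv.symm_apply_eq]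
    exact Subtype.ext h1.symm
  refine (congrArg Θ₀ h2).trans ?_
  simp [Θ₀, Algebra.ofId_apply]

end Extension

/-! ### A Tsen theorem for Grassmannians -/

section Tsen

open MvPolynomial

/-- The maximal minor of the generic matrix over a ring `R`. -/
def minorOver (R : Type*) [CommRing R] (p N : ℕ) (I : PluckerIndex p N) :
    MvPolynomial (Fin (p + 1) × Fin (N + 1)) R :=
  Matrix.det (Matrix.of fun i j : Fin (p + 1) => X (i, I j))

lemma minorOver_isHomogeneous (R : Type*) [CommRing R] (p N : ℕ) (I : PluckerIndex p N) :
    (minorOver R p N I).IsHomogeneous (p + 1) := by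
  rw [minorOver, Matrix.det_apply]
  refine IsHomogeneous.sum _ _ _ fun τ _ => ?_
  have h : (∏ i : Fin (p + 1), (Matrix.of fun i j : Fin (p + 1) =>
      (X (i, I j) : MvPolynomial (Fin (p + 1) × Fin (N + 1)) R))
        (τ i) i).IsHomogeneous (∑ _i : Fin (p + 1), 1) :=
    IsHomogeneous.prod _ _ _ fun i _ => isHomogeneous_X R _
  simp only [Finset.sum_const, Finset.card_univ, Fintype.card_fin, smul_eq_mul, mul_one] at h
  rcases Int.units_eq_one_or (Equiv.Perm.sign τ) with hs | hs
  · simpa [hs] using h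
  · simpa [hs] using h.neg

lemma map_minorOver {R S : Type*} [CommRing R] [CommRing S] (f : R →+* S) (p N : ℕ)
    (I : PluckerIndex p N) : map f (minorOver R p N I) = minorOver S p N I := by
  rw [minorOver, RingHom.map_det, minorOver]
  congr 1
  ext i j
  simp

namespace PoleFiltration

variable {k K : Type*} [Field k] [Field K] [Algebra k K] (Φ : PoleFiltration k K)

lemma finite_W (d : ℕ) : Module.Finite k (Φ.W d) :=
  Module.finite_of_finrank_pos (by
    rw [Φ.finrank_W]; exact Nat.mul_pos Φ.n_pos (Nat.succ_pos d))

lemma mul_pow_le (e d m : ℕ) : Φ.W e * Φ.W d ^ m ≤ Φ.W (e + m * (d + Φ.shift)) := by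
  induction m with
  | zero => simp
  | succ m ih =>
    rw [pow_succ, ← mul_assoc]
    refine (mul_le_mul_left ih _).trans ?_
    rw [Submodule.mul_le]
    intro y hy z hz
    convert Φ.mul_mem hy hz using 2
    ring

/-- The coefficients of a combination of the rows `x ^ d • e_i + e_{i+1}` that has bounded poles. -/
lemma mem_W_zero_of_bidiagonal {d p : ℕ} (a : ℕ → K) (ha : ∀ t, p < t → a t = 0)
    (h0 : Φ.x ^ d * a 0 ∈ Φ.W d) (h : ∀ t ≤ p, Φ.x ^ d * a (t + 1) + a t ∈ Φ.W d) (t : ℕ) :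
    a t ∈ Φ.W 0 := by
  -- `mem_zero` needs some a priori bound on the poles. Descending from `a t = 0` for `t > p`, the
  -- relations provide one. The sharp bound then comes by ascending from `a 0`.
  have h1 : ∀ s t, p < t + s → ∃ e, a t ∈ Φ.W e := by
    intro s
    induction s with
    | zero => exact fun t ht => ⟨0, by rw [ha t (by omega)]; exact Submodule.zero_mem _⟩
    | succ s ih =>
      intro t ht
      obtain ⟨e, he⟩ := ih (t + 1) (by omega)
      by_cases htp : t ≤ p
      · refine ⟨e + d, ?_⟩
        have h2 := Submodule.sub_mem _ (Φ.monotone_W (Nat.le_add_left d e) (h t htp))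
          (Φ.pow_mul_mem d he)
        rwa [add_sub_cancel_left] at h2
      · exact ⟨0, by rw [ha t (by omega)]; exact Submodule.zero_mem _⟩
  have h2 : ∀ t, ∃ e, a t ∈ Φ.W e := fun t => h1 (p + 1) t (by omega)
  induction t with
  | zero => exact Φ.mem_zero (h2 0).choose_spec h0
  | succ t ih =>
    by_cases htp : t ≤ p
    · refine Φ.mem_zero (d := d) (h2 (t + 1)).choose_spec ?_
      have h3 := Submodule.sub_mem _ (h t htp) (Φ.monotone_W (Nat.zero_le d) ih)
      rwa [add_sub_cancel_right] at h3
    · rw [ha _ (by omega)]; exact Submodule.zero_mem _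

/-- The rows `x ^ d • e_i + e_{i+1}` of a `(p+1) × (N+1)` matrix. -/
def bidiagonal (p N d : ℕ) : Matrix (Fin (p + 1)) (Fin (N + 1)) K :=
  Matrix.of fun i j => if (j : ℕ) = i then Φ.x ^ d else if (j : ℕ) = i + 1 then 1 else 0

lemma sum_mul_bidiagonal {p N : ℕ} (d : ℕ) (a : Fin (p + 1) → K) (j : Fin (N + 1)) :
    ∑ i, a i * Φ.bidiagonal p N d i j =
      Φ.x ^ d * (if h : (j : ℕ) < p + 1 then a ⟨j, h⟩ else 0) +
        (if h : 0 < (j : ℕ) ∧ (j : ℕ) < p + 2 then a ⟨j - 1, by omega⟩ else 0) := by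
  have h1 : ∀ i, a i * Φ.bidiagonal p N d i j =
      (if (j : ℕ) = i then Φ.x ^ d * a i else 0) + (if (j : ℕ) = i + 1 then a i else 0) := fun i => by
    simp only [bidiagonal, Matrix.of_apply]
    by_cases h2 : (j : ℕ) = i
    · rw [if_pos h2, if_pos h2, if_neg (by omega)]; ring
    · rw [if_neg h2, if_neg h2]
      split_ifs <;> simp
  simp only [h1, Finset.sum_add_distrib]
  congr 1
  · split_ifs with h
    · rw [Finset.sum_eq_single ⟨j, h⟩]
      · simp
      · intro b _ hb
        exact if_neg fun hc => hb (Fin.ext hc.symm)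
      · simp
    · rw [mul_zero]
      exact Finset.sum_eq_zero fun i _ => if_neg (by omega)
  · split_ifs with h
    · rw [Finset.sum_eq_single ⟨j - 1, by omega⟩]
      · rw [if_pos]; simp; omega
      · intro b _ hb
        exact if_neg fun hc => hb (Fin.ext (by simp; omega))
      · simp
    · exact Finset.sum_eq_zero fun i _ => if_neg (by omega)

/-- Column `t + 1` of the combination is `x ^ d * a (t + 1) + a t`, with `a` extended by zero beyond
`p`. The columns `0, …, p + 1` all exist because `p < N`, and they supply every relation required by
`mem_W_zero_of_bidiagonal`. -/
lemma mem_W_zero_of_sum_bidiagonal {p N : ℕ} (hpN : p < N) (d : ℕ) (a : Fin (p + 1) → K)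
    (h : ∀ j, ∑ i, a i * Φ.bidiagonal p N d i j ∈ Φ.W d) (i : Fin (p + 1)) : a i ∈ Φ.W 0 := by
  simp only [sum_mul_bidiagonal] at h
  let a' : ℕ → K := fun t => if h : t < p + 1 then a ⟨t, h⟩ else 0
  have h1 := Φ.mem_W_zero_of_bidiagonal (d := d) (p := p) a' (fun t ht => dif_neg (by omega)) ?_ ?_ i
  · simpa [a', Nat.lt_succ_iff.mp i.2] using h1
  · simpa [a'] using h 0
  · intro t ht
    have h2 := h ⟨t + 1, by omega⟩
    have h3 : t < p + 1 := by omega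
    simpa [a', h3, ht] using h2

/-- The entries `1` serve as pivots: column `t + 1` expresses `a t` through `a (t + 1)`, so
descending induction applies without any condition on `x`. -/
lemma linearIndependent_bidiagonal {p N : ℕ} (hpN : p < N) (d : ℕ) :
    LinearIndependent K (Φ.bidiagonal p N d).row := by
  rw [Fintype.linearIndependent_iff]
  intro a ha
  have h : ∀ j, ∑ i, a i * Φ.bidiagonal p N d i j = 0 := fun j => by
    simpa [Finset.sum_apply] using congr_fun ha j
  simp only [sum_mul_bidiagonal] at h
  have h1 : ∀ s t, p + 1 ≤ t + s → (if h : t < p + 1 then a ⟨t, h⟩ else 0) = 0 := by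
    intro s
    induction s with
    | zero => exact fun t ht => dif_neg (by omega)
    | succ s ih =>
      intro t ht
      by_cases htp : t < p + 1
      · have h2 := h ⟨t + 1, by omega⟩
        have h3 := ih (t + 1) (by omega)
        simp only at h2
        rw [h3] at h2
        simpa [htp] using h2
      · exact dif_neg htp
  intro i
  simpa [Nat.lt_succ_iff.mp i.2] using h1 (p + 1) i (by omega)

end PoleFiltration

end Tsen

/-! ### Generic matrices with bounded poles, and the derivatives of their minors -/

section Tsen

open MvPolynomial

namespace PoleFiltration

variable {k K : Type*} [Field k] [Field K] [Algebra k K] (Φ : PoleFiltration k K)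

/-- A basis of `W d`. -/
def basisW (d : ℕ) : Module.Basis (Fin (Φ.n * (d + 1))) k (Φ.W d) :=
  have := Φ.finite_W d
  Module.finBasisOfFinrankEq k (Φ.W d) (Φ.finrank_W d)

/-- The generic `(p+1) × (N+1)` matrix with entries in `W d`. -/
def genericMatrix (p N d : ℕ) (t : Fin (p + 1) × Fin (N + 1)) :
    MvPolynomial (Fin (p + 1) × Fin (N + 1) × Fin (Φ.n * (d + 1))) K :=
  ∑ l, C (Φ.basisW d l : K) * X (t.1, t.2, l)

/-- The `(p+1) × (N+1)` matrix with entries in `W d` and given coordinates. -/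
def matrixOfCoords (p N d : ℕ) : (Fin (p + 1) × Fin (N + 1) × Fin (Φ.n * (d + 1)) → k) →ₗ[k]
    Fin (p + 1) → Fin (N + 1) → K :=
  LinearMap.pi fun i => LinearMap.pi fun j =>
    ∑ l, (LinearMap.toSpanSingleton k K (Φ.basisW d l : K)).comp (LinearMap.proj (i, j, l))

lemma matrixOfCoords_apply (p N d : ℕ) (v : _ → k) (i : Fin (p + 1)) (j : Fin (N + 1)) :
    Φ.matrixOfCoords p N d v i j = ∑ l, v (i, j, l) • (Φ.basisW d l : K) := by
  simp [matrixOfCoords]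

lemma matrixOfCoords_apply_coe (p N d : ℕ) (v : _ → k) (i : Fin (p + 1)) (j : Fin (N + 1)) :
    Φ.matrixOfCoords p N d v i j =
      ((Φ.basisW d).equivFun.symm (fun l => v (i, j, l)) : Φ.W d) := by
  rw [matrixOfCoords_apply, Module.Basis.equivFun_symm_apply]
  simp

lemma matrixOfCoords_mem (p N d : ℕ) (v : _ → k) (i : Fin (p + 1)) (j : Fin (N + 1)) :
    Φ.matrixOfCoords p N d v i j ∈ Φ.W d := by
  rw [matrixOfCoords_apply_coe]
  exact Subtype.property _

lemma matrixOfCoords_injective (p N d : ℕ) : Function.Injective (Φ.matrixOfCoords p N d) := by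
  intro v v' h
  ext ⟨i, j, l⟩
  have h1 := congr_fun (congr_fun h i) j
  rw [matrixOfCoords_apply_coe, matrixOfCoords_apply_coe] at h1
  exact congr_fun ((Φ.basisW d).equivFun.symm.injective (Subtype.ext h1)) l

lemma exists_matrixOfCoords_eq (p N d : ℕ) (M : Fin (p + 1) → Fin (N + 1) → K)
    (hM : ∀ i j, M i j ∈ Φ.W d) : ∃ v, Φ.matrixOfCoords p N d v = M := by
  refine ⟨fun t => (Φ.basisW d).equivFun ⟨M t.1 t.2.1, hM _ _⟩ t.2.2, ?_⟩
  ext i j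
  rw [matrixOfCoords_apply_coe]
  exact congrArg Subtype.val ((Φ.basisW d).equivFun.symm_apply_apply ⟨M i j, hM i j⟩)

lemma genericMatrix_mem (p N d : ℕ) (t : Fin (p + 1) × Fin (N + 1)) :
    Φ.genericMatrix p N d t ∈ formsOver _ (Φ.W d) 1 :=
  Submodule.sum_mem _ fun l _ => Submodule.subset_span
    ⟨Φ.basisW d l, Subtype.property _, X (t.1, t.2, l), isHomogeneous_X _ _, by simp⟩

lemma aeval_genericMatrix_minorOver (p N d : ℕ) (I : PluckerIndex p N) :
    aeval (Φ.genericMatrix p N d) (minorOver K p N I) =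
      (Matrix.of fun i j : Fin (p + 1) => Φ.genericMatrix p N d (i, I j)).det := by
  rw [minorOver, AlgHom.map_det]
  congr 1
  ext i j
  simp

/-- The derivative of a minor of the generic matrix at the point `pt` in the direction `v`. -/
lemma sum_mul_eval_pderiv_minor (p N d : ℕ) (pt v : _ → k) (I : PluckerIndex p N) :
    ∑ s, algebraMap k K (v s) * eval (algebraMap k K ∘ pt)
        (pderiv s (aeval (Φ.genericMatrix p N d) (minorOver K p N I))) =
      ∑ j, (((Matrix.of (Φ.matrixOfCoords p N d pt)).updateRow j
        (Φ.matrixOfCoords p N d v j)).submatrix id I).det := by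
  classical
  let D : Derivation K (MvPolynomial (Fin (p + 1) × Fin (N + 1) × Fin (Φ.n * (d + 1))) K)
      (MvPolynomial (Fin (p + 1) × Fin (N + 1) × Fin (Φ.n * (d + 1))) K) :=
    ∑ s, (algebraMap k K (v s)) • pderiv s
  have hD : ∀ H, D H = ∑ s, C (algebraMap k K (v s)) * pderiv s H := fun H => by
    have h1 : D H = ∑ s, ((algebraMap k K (v s)) • pderiv s) H := by
      rw [← Derivation.coeFnAddMonoidHom_apply, map_sum, Finset.sum_apply]
      rfl
    rw [h1]
    refine Finset.sum_congr rfl fun s _ => ?_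
    rw [Derivation.smul_apply, MvPolynomial.smul_eq_C_mul]
  have h1 : eval (algebraMap k K ∘ pt) (D (aeval (Φ.genericMatrix p N d) (minorOver K p N I))) =
      ∑ s, algebraMap k K (v s) * eval (algebraMap k K ∘ pt)
        (pderiv s (aeval (Φ.genericMatrix p N d) (minorOver K p N I))) := by
    rw [hD, map_sum]
    simp
  have h2 : ∀ t : Fin (p + 1) × Fin (N + 1), eval (algebraMap k K ∘ pt) (Φ.genericMatrix p N d t) =
      Φ.matrixOfCoords p N d pt t.1 t.2 := fun t => by
    rw [matrixOfCoords_apply, genericMatrix, map_sum]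
    refine Finset.sum_congr rfl fun l _ => ?_
    simp [Algebra.smul_def, mul_comm]
  have h3 : ∀ t : Fin (p + 1) × Fin (N + 1), eval (algebraMap k K ∘ pt)
      (D (Φ.genericMatrix p N d t)) = Φ.matrixOfCoords p N d v t.1 t.2 := fun t => by
    have hX : ∀ s, D (X s) = C (algebraMap k K (v s)) := fun s => by
      rw [hD, Finset.sum_eq_single s]
      · simp
      · intro b _ hb
        rw [pderiv_X_of_ne (Ne.symm hb), mul_zero]
      · simp
    rw [matrixOfCoords_apply, genericMatrix, map_sum, map_sum]
    refine Finset.sum_congr rfl fun l _ => ?_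
    rw [← MvPolynomial.smul_eq_C_mul, D.map_smul, hX, MvPolynomial.smul_eq_C_mul]
    simp [Algebra.smul_def, mul_comm]
  rw [← h1, aeval_genericMatrix_minorOver, derivation_det, map_sum]
  refine Finset.sum_congr rfl fun j _ => ?_
  rw [RingHom.map_det]
  congr 1
  ext a b
  simp only [RingHom.mapMatrix_apply, Matrix.map_apply, Matrix.submatrix_apply, id_eq]
  by_cases ha : a = j
  · subst ha
    simp only [Matrix.updateRow_self, Matrix.of_apply]
    exact h3 _
  · simp only [Matrix.updateRow_ne ha, Matrix.of_apply]
    exact h2 _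

/-- The matrix whose rows are the combinations of the rows of `bidiagonal` with coefficients `a`. -/
def combineRows (p N d : ℕ) :
    (Fin (p + 1) → Fin (p + 1) → Φ.W 0) →ₗ[k] Fin (p + 1) → Fin (N + 1) → K where
  toFun a i j := ∑ t, (a i t : K) * Φ.bidiagonal p N d t j
  map_add' a a' := by
    ext i j
    simp [add_mul, Finset.sum_add_distrib]
  map_smul' r a := by
    ext i j
    simp [Finset.smul_sum]

/-- The coordinates of the matrices whose rows are combinations, with coefficients in `W 0`, of the
rows of `bidiagonal`. -/
def rowSpan (p N d : ℕ) :
    Submodule k (Fin (p + 1) × Fin (N + 1) × Fin (Φ.n * (d + 1)) → k) :=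
  (LinearMap.range (Φ.combineRows p N d)).comap (Φ.matrixOfCoords p N d)

lemma mem_rowSpan {p N d : ℕ} (v : _ → k) (a : Fin (p + 1) → Fin (p + 1) → K)
    (ha : ∀ i t, a i t ∈ Φ.W 0)
    (h : ∀ i j, Φ.matrixOfCoords p N d v i j = ∑ t, a i t * Φ.bidiagonal p N d t j) :
    v ∈ Φ.rowSpan p N d := by
  refine ⟨fun i t => ⟨a i t, ha i t⟩, ?_⟩
  ext i j
  exact (h i j).symm

/-- The essential point is that the bound does not involve `d`: the row combinations are
parametrized by `(p+1)²` coefficients in `W 0`. -/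
lemma finrank_rowSpan_le (p N d : ℕ) :
    Module.finrank k (Φ.rowSpan p N d) ≤ (p + 1) * ((p + 1) * Φ.n) := by
  have := Φ.finite_W 0
  have h1 : Module.finrank k ((Φ.rowSpan p N d).map (Φ.matrixOfCoords p N d)) ≤
      Module.finrank k (LinearMap.range (Φ.combineRows p N d)) :=
    Submodule.finrank_mono (Submodule.map_comap_le _ _)
  rw [← (Submodule.equivMapOfInjective _ (Φ.matrixOfCoords_injective p N d)
    (Φ.rowSpan p N d)).finrank_eq] at h1
  refine h1.trans ((LinearMap.finrank_range_le _).trans ?_)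
  simp [Module.finrank_pi_fintype, Φ.finrank_W]

end PoleFiltration

end Tsen

/-! ### Common zeros on the Grassmannian by counting parameters -/

section Tsen

open MvPolynomial

namespace PoleFiltration

variable {k K : Type*} [Field k] [Field K] [Algebra k K] (Φ : PoleFiltration k K)

lemma exists_ne_zero_mem_W_zero : ∃ y ∈ Φ.W 0, y ≠ 0 := by
  by_contra! h
  have h1 : Φ.W 0 = ⊥ := (Submodule.eq_bot_iff _).mpr h
  have h2 := Φ.finrank_W 0
  have := Φ.n_pos
  rw [h1, finrank_bot] at h2
  omega

/-- At a suitable point, the common kernel of the differentials of the components of the minors of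
the generic matrix is contained in `rowSpan`. -/
lemma exists_point_of_minor_components {p N : ℕ} (hpN : p < N) (d : ℕ) {ι : Type*} [Fintype ι]
    (u : ι → K) (g : PluckerIndex p N → ι →
      MvPolynomial (Fin (p + 1) × Fin (N + 1) × Fin (Φ.n * (d + 1))) k)
    (hg : ∀ I, aeval (Φ.genericMatrix p N d) (minorOver K p N I) =
      ∑ l, C (u l) * map (algebraMap k K) (g I l)) :
    ∃ pt : Fin (p + 1) × Fin (N + 1) × Fin (Φ.n * (d + 1)) → k, ∀ v,
      (∀ I l, ∑ s, v s * eval pt (pderiv s (g I l)) = 0) → v ∈ Φ.rowSpan p N d := by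
  -- The axioms do not place `1` in `W 0`, so the bidiagonal matrix is scaled by a nonzero `y ∈ W 0`
  -- to have its entries in `W d`.
  obtain ⟨y, hy, hy0⟩ := Φ.exists_ne_zero_mem_W_zero
  obtain ⟨pt, hpt⟩ := Φ.exists_matrixOfCoords_eq p N d
    (fun i j => y * Φ.bidiagonal p N d i j) fun i j => by
      simp only [bidiagonal, Matrix.of_apply]
      split_ifs
      · rw [mul_comm]
        simpa using Φ.pow_mul_mem d hy
      · simpa using Φ.monotone_W (Nat.zero_le d) hy
      · simp
  refine ⟨pt, fun v hv => ?_⟩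
  have h1 : ∀ I : PluckerIndex p N, ∑ j, (((Matrix.of (Φ.matrixOfCoords p N d pt)).updateRow j
      (Φ.matrixOfCoords p N d v j)).submatrix id I).det = 0 := by
    intro I
    rw [← sum_mul_eval_pderiv_minor, hg]
    have h2 : ∀ s, algebraMap k K (v s) * eval (algebraMap k K ∘ pt)
        (pderiv s (∑ l, C (u l) * map (algebraMap k K) (g I l))) =
        ∑ l, u l * algebraMap k K (v s * eval pt (pderiv s (g I l))) := fun s => by
      rw [map_sum, map_sum, Finset.mul_sum]
      refine Finset.sum_congr rfl fun l _ => ?_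
      rw [pderiv_C_mul, pderiv_map, map_mul, eval_C, ← map_eval, map_mul]
      ring
    simp only [h2]
    rw [Finset.sum_comm]
    refine Finset.sum_eq_zero fun l _ => ?_
    rw [← Finset.mul_sum, ← map_sum, hv, map_zero, mul_zero]
  have hli : LinearIndependent K (Matrix.of (Φ.matrixOfCoords p N d pt)).row := by
    have h3 := (Φ.linearIndependent_bidiagonal hpN d).units_smul fun _ => Units.mk0 y hy0
    convert h3 using 1
    ext i j
    simp [hpt, Matrix.row]
    rfl
  -- Row `i` of `v` is a `K`-combination of the bidiagonal rows, and its entries lie in `W d`; this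
  -- forces the coefficients into `W 0`.
  have h4 : ∀ i, ∃ a : Fin (p + 1) → K, (∀ t, a t ∈ Φ.W 0) ∧
      ∀ j, Φ.matrixOfCoords p N d v i j = ∑ t, a t * Φ.bidiagonal p N d t j := by
    intro i
    have h5 := mem_span_of_sum_det_updateRow_eq_zero _ _ hli h1 i
    obtain ⟨a, ha⟩ := (Submodule.mem_span_range_iff_exists_fun K).mp h5
    have h6 : ∀ j, Φ.matrixOfCoords p N d v i j = ∑ t, (a t * y) * Φ.bidiagonal p N d t j := by
      intro j
      rw [← congr_fun ha j, Finset.sum_apply]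
      refine Finset.sum_congr rfl fun t _ => ?_
      simp [Matrix.row, hpt, mul_assoc]
    refine ⟨fun t => a t * y, fun t => ?_, h6⟩
    refine Φ.mem_W_zero_of_sum_bidiagonal hpN d (fun t => a t * y) (fun j => ?_) t
    rw [← h6]
    exact Φ.matrixOfCoords_mem p N d v i j
  choose a ha ha' using h4
  exact Φ.mem_rowSpan v a ha ha'

/-- After division by `n`, the coefficient of `d` is `(p+1) * ∑ κ ≤ (p+1) * N` on the left and
`(p+1) * (N+1)` on the right. The right side thus has a spare `d`, which is chosen equal to the sum
of the constants to be absorbed. -/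
lemma card_lt_aux {c p N n e s : ℕ} (hn : 0 < n) (κ : Fin c → ℕ) (hsum : ∑ m, κ m < N + 1) :
    let d := c * (e + 1) + (p + 1) * N * s + (p + 1) * (p + 1)
    (∑ m, n * (e + (p + 1) * κ m * (d + s) + 1)) + (p + 1) * ((p + 1) * n) <
      (p + 1) * ((N + 1) * (n * (d + 1))) := by
  intro d
  have h1 : ∑ m, n * (e + (p + 1) * κ m * (d + s) + 1) =
      n * (c * (e + 1) + (p + 1) * (∑ m, κ m) * (d + s)) := by
    rw [← Finset.mul_sum]
    congr 1
    have h2 : ∀ m, e + (p + 1) * κ m * (d + s) + 1 = (e + 1) + (p + 1) * (d + s) * κ m :=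
      fun m => by ring
    simp only [h2, Finset.sum_add_distrib, ← Finset.mul_sum]
    simp
    ring
  rw [h1]
  have h3 : (p + 1) * (∑ m, κ m) * (d + s) ≤ (p + 1) * N * (d + s) :=
    Nat.mul_le_mul_right _ (Nat.mul_le_mul_left _ (by omega))
  have h4 : c * (e + 1) + (p + 1) * (∑ m, κ m) * (d + s) + (p + 1) * (p + 1) <
      (p + 1) * ((N + 1) * (d + 1)) := by
    have h5 : (p + 1) * ((N + 1) * (d + 1)) = (p + 1) * N * d + (p + 1) * N + p * (d + 1) + d + 1 := by
      ring
    have h6 : (p + 1) * N * (d + s) = (p + 1) * N * d + (p + 1) * N * s := by ring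
    have h7 : d = c * (e + 1) + (p + 1) * N * s + (p + 1) * (p + 1) := rfl
    rw [h5]
    rw [h6] at h3
    omega
  calc _ = n * (c * (e + 1) + (p + 1) * (∑ m, κ m) * (d + s) + (p + 1) * (p + 1)) := by ring
    _ < n * ((p + 1) * ((N + 1) * (d + 1))) := (Nat.mul_lt_mul_left hn).mpr h4
    _ = _ := by ring

variable [IsAlgClosed k] [CharZero k]

/-- Forms with coefficients of bounded poles have a common zero on the Grassmannian, in the form of
a point of an algebra that contains the forms and the minors. -/
lemma exists_zero_of_coeff_mem (Φ : PoleFiltration k K) {p N : ℕ} (hpN : p < N) {c : ℕ} (κ : Fin c → ℕ)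
    (hκ : ∀ m, 0 < κ m) (hsum : ∑ m, κ m < N + 1)
    (F : Fin c → MvPolynomial (Fin (p + 1) × Fin (N + 1)) K)
    (hF : ∀ m, (F m).IsHomogeneous ((p + 1) * κ m)) (e : ℕ)
    (he : ∀ m μ, coeff μ (F m) ∈ Φ.W e) :
    ∃ (Q : Subalgebra K (MvPolynomial (Fin (p + 1) × Fin (N + 1)) K)) (Θ : Q →ₐ[K] K),
      (∀ I, minorOver K p N I ∈ Q) ∧ (∀ m, ∃ h : F m ∈ Q, Θ ⟨F m, h⟩ = 0) ∧
      ∃ I, ∃ h : minorOver K p N I ∈ Q, Θ ⟨minorOver K p N I, h⟩ ≠ 0 := by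
  set d := c * (e + 1) + (p + 1) * N * Φ.shift + (p + 1) * (p + 1) with hd
  let G := Φ.genericMatrix p N d
  -- The minors have constant coefficients, hence the factor `1`. The dimension of `U₀` does not
  -- matter, since the minor components are not equations to be solved.
  let U₀ : Submodule k K := 1 * Φ.W d ^ (p + 1)
  have hU₀ : Module.Finite k U₀ := by
    have := Φ.finite_W d
    rw [Module.Finite.iff_fg]
    exact Submodule.FG.mul ⟨{1}, by rw [Finset.coe_singleton, Submodule.one_eq_span]⟩ (Submodule.FG.pow (Module.Finite.iff_fg.mp this) _)
  let b₀ := Module.finBasis k U₀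
  have hminor : ∀ I, aeval G (minorOver K p N I) ∈ formsOver _ U₀ (p + 1) := fun I => by
    refine aeval_mem_formsOver (Φ.genericMatrix_mem p N d) (minorOver_isHomogeneous K p N I) ?_
    intro μ
    rw [← map_minorOver (algebraMap k K), coeff_map]
    exact Submodule.mem_one.mpr ⟨_, rfl⟩
  choose g hg hg' using fun I => exists_eq_sum_of_mem_formsOver b₀ (hminor I)
  let E : Fin c → ℕ := fun m => e + (p + 1) * κ m * (d + Φ.shift)
  have hform : ∀ m, aeval G (F m) ∈ formsOver _ (Φ.W (E m)) ((p + 1) * κ m) := fun m =>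
    formsOver_mono (Φ.mul_pow_le e d _) _
      (aeval_mem_formsOver (Φ.genericMatrix_mem p N d) (hF m) (he m))
  choose f hf hf' using fun m => exists_eq_sum_of_mem_formsOver (Φ.basisW (E m)) (hform m)
  obtain ⟨pt, hpt⟩ := Φ.exists_point_of_minor_components hpN d (fun l => (b₀ l : K)) g hg'
  obtain ⟨φ, hφ, ⟨I, l⟩, hφ'⟩ := exists_algHom_of_card_lt
    (fun a : PluckerIndex p N × Fin (Module.finrank k U₀) => g a.1 a.2) (p + 1)
    (fun a => hg a.1 a.2) (fun a : Σ m, Fin (Φ.n * (E m + 1)) => f a.1 a.2)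
    (fun a => (p + 1) * κ a.1) (fun a => Nat.mul_pos (Nat.succ_pos p) (hκ a.1))
    (fun a => hf a.1 a.2) pt (Φ.rowSpan p N d) (fun v hv => hpt v fun I l => hv (I, l)) (by
      refine lt_of_le_of_lt (Nat.add_le_add_left (Φ.finrank_rowSpan_le p N d) _) ?_
      simpa using card_lt_aux (p := p) (e := e) (s := Φ.shift) Φ.n_pos κ hsum)
  obtain ⟨Q, Θ, hΘ⟩ := exists_algHom_extension (K := K) _ φ
  have hminorQ : ∀ I, ∃ hQ : aeval G (minorOver K p N I) ∈ Q, Θ ⟨_, hQ⟩ = ∑ l, (b₀ l : K) *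
      algebraMap k K (φ ⟨g I l, Algebra.subset_adjoin ⟨Sum.inl (I, l), rfl⟩⟩) := fun I => by
    rw [hg' I]
    exact hΘ (fun l => (b₀ l : K)) fun l => ⟨g I l, Algebra.subset_adjoin ⟨Sum.inl (I, l), rfl⟩⟩
  have hformQ : ∀ m, ∃ hQ : aeval G (F m) ∈ Q, Θ ⟨_, hQ⟩ = 0 := fun m => by
    rw [hf' m]
    obtain ⟨hQ, h⟩ := hΘ (fun l => (Φ.basisW (E m) l : K))
      fun l => ⟨f m l, Algebra.subset_adjoin ⟨Sum.inr ⟨m, l⟩, rfl⟩⟩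
    refine ⟨hQ, h.trans (Finset.sum_eq_zero fun l _ => ?_)⟩
    rw [hφ ⟨m, l⟩, map_zero, mul_zero]
  -- Substitution of the generic matrix brings the point back to an algebra of polynomials in the
  -- original matrix entries.
  refine ⟨Q.comap (aeval G), Θ.comp (((aeval G).comp (Q.comap (aeval G)).val).codRestrict Q
    fun x => x.2), fun I => (hminorQ I).1, fun m => ⟨(hformQ m).1, (hformQ m).2⟩,
    I, (hminorQ I).1, fun h0 => hφ' ?_⟩
  have h1 : ∑ l, (b₀ l : K) *
      algebraMap k K (φ ⟨g I l, Algebra.subset_adjoin ⟨Sum.inl (I, l), rfl⟩⟩) = 0 :=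
    (hminorQ I).2.symm.trans h0
  -- Since `b₀` is linearly independent over `k`, a minor with one nonzero component has a nonzero
  -- value in `K`.
  have h2 : ∑ l, (φ ⟨g I l, Algebra.subset_adjoin ⟨Sum.inl (I, l), rfl⟩⟩) • b₀ l = 0 := by
    refine Subtype.ext ?_
    rw [AddSubmonoidClass.coe_finsetSum, Submodule.coe_zero, ← h1]
    refine Finset.sum_congr rfl fun l _ => ?_
    rw [Submodule.coe_smul, Algebra.smul_def, mul_comm]
  exact Fintype.linearIndependent_iff.mp b₀.linearIndependent _ h2 l

/-- Forms of degrees `(p + 1) * κ m` with `∑ κ m ≤ N` have a common zero on the Grassmannian, in the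
form of a point of an algebra that contains the forms and the minors. -/
theorem exists_zero (Φ : PoleFiltration k K) {p N : ℕ} (hpN : p < N) {c : ℕ} (κ : Fin c → ℕ)
    (hκ : ∀ m, 0 < κ m) (hsum : ∑ m, κ m < N + 1)
    (F : Fin c → MvPolynomial (Fin (p + 1) × Fin (N + 1)) K)
    (hF : ∀ m, (F m).IsHomogeneous ((p + 1) * κ m)) :
    ∃ (Q : Subalgebra K (MvPolynomial (Fin (p + 1) × Fin (N + 1)) K)) (Θ : Q →ₐ[K] K),
      (∀ I, minorOver K p N I ∈ Q) ∧ (∀ m, ∃ h : F m ∈ Q, Θ ⟨F m, h⟩ = 0) ∧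
      ∃ I, ∃ h : minorOver K p N I ∈ Q, Θ ⟨minorOver K p N I, h⟩ ≠ 0 := by
  classical
  -- Clearing denominators: one nonzero factor `q` gives all coefficients poles of order at most
  -- `e`, and scaling does not affect zeros.
  obtain ⟨q, hq, e, he⟩ := Φ.exists_scale
    (Finset.univ.biUnion fun m => (F m).support.image fun μ => coeff μ (F m))
  obtain ⟨Q, Θ, h1, h2, h3⟩ := Φ.exists_zero_of_coeff_mem hpN κ hκ hsum (fun m => q • F m)
    (fun m => by rw [smul_eq_C_mul]; exact (hF m).C_mul q) e fun m μ => by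
      rw [coeff_smul, smul_eq_mul]
      by_cases hμ : coeff μ (F m) = 0
      · rw [hμ, mul_zero]; exact Submodule.zero_mem _
      · refine he _ (Finset.mem_biUnion.mpr ⟨m, Finset.mem_univ _, Finset.mem_image.mpr
          ⟨μ, mem_support_iff.mpr hμ, rfl⟩⟩)
  refine ⟨Q, Θ, h1, fun m => ?_, h3⟩
  obtain ⟨hQ, h⟩ := h2 m
  have h4 : F m = q⁻¹ • q • F m := (inv_smul_smul₀ hq _).symm
  have h5 : F m ∈ Q := by
    rw [h4]
    exact Q.smul_mem hQ _
  refine ⟨h5, ?_⟩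
  have h6 : (⟨F m, h5⟩ : Q) = q⁻¹ • ⟨q • F m, hQ⟩ := Subtype.ext h4
  rw [h6, map_smul, h, smul_zero]

end PoleFiltration

end Tsen

/-! ### Étale algebras over a polynomial ring in one variable -/

section EtaleOverLine

open Polynomial

lemma valuationRing_of_isPrincipal_maximalIdeal (A : Type*) [CommRing A] [IsDomain A]
    [IsLocalRing A] [IsNoetherianRing A] (h : (IsLocalRing.maximalIdeal A).IsPrincipal) :
    ValuationRing A := by
  by_cases hA : IsField A
  · let := hA.toField
    exact ValuationRing.of_field A
  · exact ((IsDiscreteValuationRing.TFAE A hA).out 4 1).mp h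

/-- The local rings of an étale algebra over a principal ideal domain are valuation rings. -/
lemma valuationRing_of_etale (R S A : Type*) [CommRing R] [IsDomain R] [IsPrincipalIdealRing R]
    [CommRing S] [Algebra R S] [Algebra.Etale R S] (P : Ideal S) [P.IsPrime] [CommRing A]
    [IsDomain A] [Algebra S A] [IsLocalization.AtPrime A P] : ValuationRing A := by
  let p := P.under R
  let Rp := Localization.AtPrime p
  let SP := Localization.AtPrime P
  let := Localization.AtPrime.algebraOfLiesOver p P
  have := Algebra.FormallyUnramified.of_isLocalization (Rₘ := SP) P.primeCompl
  have : Algebra.FormallyUnramified R SP := .comp R S SP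
  have : Algebra.FormallyUnramified Rp SP := .of_restrictScalars R Rp SP
  have : Algebra.EssFiniteType S SP := .of_isLocalization SP P.primeCompl
  have : Algebra.EssFiniteType R SP := .comp R S SP
  have : Algebra.EssFiniteType Rp SP := .of_comp R Rp SP
  have : IsNoetherianRing S := Algebra.FiniteType.isNoetherianRing R S
  have : IsNoetherianRing SP := IsLocalization.isNoetherianRing P.primeCompl SP inferInstance
  let e : SP ≃ₐ[S] A := IsLocalization.algEquiv P.primeCompl SP A
  have : IsDomain SP := e.toMulEquiv.isDomain A
  -- Unramifiedness: the maximal ideal of `SP` is generated by that of `Rp`, which comes from a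
  -- principal ideal of `R`.
  have h1 := Algebra.FormallyUnramified.map_maximalIdeal (R := Rp) (S := SP)
  have h2 : (IsLocalRing.maximalIdeal SP).IsPrincipal := by
    rw [← h1, ← Localization.AtPrime.map_eq_maximalIdeal, Ideal.map_map]
    infer_instance
  have := valuationRing_of_isPrincipal_maximalIdeal SP h2
  refine ValuationRing.iff_dvd_total.mpr ⟨fun a b => ?_⟩
  rcases ValuationRing.dvd_total (e.symm a) (e.symm b) with h | h
  · exact Or.inl ((map_dvd_iff e.symm).mp h)
  · exact Or.inr ((map_dvd_iff e.symm).mp h)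

lemma algebraMap_injective_of_etale (R S : Type*) [CommRing R] [IsDomain R]
    [CommRing S] [IsDomain S] [Algebra R S] [Algebra.Etale R S] :
    Function.Injective (algebraMap R S) :=
  FaithfulSMul.algebraMap_injective R S

/-- The fraction field of an étale algebra is finite over the fraction field of the base. -/
lemma finite_of_etale (R S F K : Type*) [CommRing R] [CommRing S] [Algebra R S] [Algebra.Etale R S]
    [Field F] [Algebra R F] [IsFractionRing R F]
    [Field K] [Algebra S K] [IsFractionRing S K] [Algebra R K] [IsScalarTower R S K]
    [Algebra F K] [IsScalarTower R F K] : Module.Finite F K := by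
  have := Algebra.FormallyUnramified.of_isLocalization (Rₘ := K) (nonZeroDivisors S)
  have : Algebra.FormallyUnramified R K := .comp R S K
  have : Algebra.FormallyUnramified F K := .of_restrictScalars R F K
  have : Algebra.EssFiniteType S K := .of_isLocalization K (nonZeroDivisors S)
  have : Algebra.EssFiniteType R K := .comp R S K
  have : Algebra.EssFiniteType F K := .of_comp R F K
  exact Algebra.FormallyUnramified.finite_of_free F K

/-- The fraction field of an étale algebra over `k[X]` has a pole filtration. -/
lemma exists_poleFiltration_of_etale {k S K : Type*} [Field k] [CharZero k] [CommRing S]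
    [IsDomain S] [Algebra k[X] S] [Algebra.Etale k[X] S] [Field K] [Algebra S K]
    [IsFractionRing S K] [Algebra k K]
    (h : algebraMap k K = ((algebraMap S K).comp (algebraMap k[X] S)).comp C) :
    Nonempty (PoleFiltration k K) := by
  let : Algebra k[X] K := ((algebraMap S K).comp (algebraMap k[X] S)).toAlgebra
  have : IsScalarTower k[X] S K := .of_algebraMap_eq' rfl
  have : IsScalarTower k k[X] K := .of_algebraMap_eq' h
  have h1 : Function.Injective (algebraMap k[X] K) :=
    (IsFractionRing.injective S K).comp (algebraMap_injective_of_etale k[X] S)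
  have : FaithfulSMul k[X] K := (faithfulSMul_iff_algebraMap_injective _ _).mpr h1
  let : Algebra (FractionRing k[X]) K := FractionRing.liftAlgebra k[X] K
  have : FiniteDimensional (FractionRing k[X]) K := finite_of_etale k[X] S _ K
  exact exists_poleFiltration k K (FractionRing k[X])

end EtaleOverLine

/-! ### Extension of points over the function field -/

section Extension

open Scheme

lemma exists_lift_of_isProper {X Y : Scheme.{0}} (π : Y ⟶ X) [IsProper π] {R K : Type} [CommRing R]
    [IsDomain R] [ValuationRing R] [Field K] [Algebra R K] [IsFractionRing R K]
    (y : Spec (.of K) ⟶ Y) (x : Spec (.of R) ⟶ X)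
    (h : y ≫ π = Spec.map (CommRingCat.ofHom (algebraMap R K)) ≫ x) :
    ∃ φ : Spec (.of R) ⟶ Y, Spec.map (CommRingCat.ofHom (algebraMap R K)) ≫ φ = y ∧ φ ≫ π = x := by
  have h1 : (ValuativeCriterion ⊓ @QuasiCompact ⊓ @QuasiSeparated ⊓ @LocallyOfFiniteType) π := by
    rw [← IsProper.eq_valuativeCriterion]
    infer_instance
  let S : ValuativeCommSq π := { R := R, K := K, i₁ := y, i₂ := x, commSq := ⟨h⟩ }
  have h2 : S.commSq.HasLift := h1.1.1.1.existence S
  exact ⟨S.commSq.lift, S.commSq.fac_left, S.commSq.fac_right⟩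

lemma specMap_algebraMap_functionField {X : Scheme.{0}} [IsIntegral X] (x : X) :
    Spec.map (CommRingCat.ofHom (algebraMap (X.presheaf.stalk x) X.functionField)) ≫
      X.fromSpecStalk x = X.fromSpecStalk (genericPoint X) := by
  have h : CommRingCat.ofHom (algebraMap (X.presheaf.stalk x) X.functionField) =
    X.presheaf.stalkSpecializes ((genericPoint_spec X).specializes trivial) := rfl
  rw [h]
  exact Scheme.SpecMap_stalkSpecializes_fromSpecStalk _

lemma specMap_stalkSpecializes_fromSpecStalkOfMem {X : Scheme.{0}} (U : X.Opens) {x y : X}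
    (h : y ⤳ x) (hx : x ∈ U) (hy : y ∈ U) :
    Spec.map (X.presheaf.stalkSpecializes h) ≫ U.fromSpecStalkOfMem x hx =
      U.fromSpecStalkOfMem y hy := by
  rw [← cancel_mono U.ι, Category.assoc, Opens.fromSpecStalkOfMem_ι, Opens.fromSpecStalkOfMem_ι]
  exact Scheme.SpecMap_stalkSpecializes_fromSpecStalk _

lemma fromFunctionField_eq_comp {X Y : Scheme.{0}} [IrreducibleSpace X] (g : X.PartialMap Y) {x : X}
    (hx : x ∈ g.domain) :
    g.fromFunctionField = Spec.map (X.presheaf.stalkSpecializes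
      ((genericPoint_spec X).specializes trivial)) ≫ g.fromSpecStalkOfMem hx := by
  rw [PartialMap.fromFunctionField, PartialMap.fromSpecStalkOfMem, PartialMap.fromSpecStalkOfMem,
    ← Category.assoc, specMap_stalkSpecializes_fromSpecStalkOfMem]

/-- A point over the function field of an integral scheme whose local rings are valuation rings
extends to a section of a proper morphism. -/
lemma exists_section_of_point {X Y : Scheme.{0}} (π : Y ⟶ X) [IsIntegral X] [X.IsSeparated]
    [IsProper π] (hX : ∀ x, ValuationRing (X.presheaf.stalk x))
    (y : Spec X.functionField ⟶ Y) (hy : y ≫ π = X.fromSpecStalk _) : ∃ s : X ⟶ Y, s ≫ π = 𝟙 X := by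
  have : Y.IsSeparated := ⟨by
    have : Limits.terminal.from Y = π ≫ Limits.terminal.from X := Limits.terminal.hom_ext _ _
    rw [this]; infer_instance⟩
  -- The generic point `y` spreads out to a rational map; it remains to show that it is defined at
  -- every `x`.
  let r : X ⤏ Y := RationalMap.ofFunctionField (𝟙 X) π y (by rw [hy, Category.comp_id])
  have hr : r.fromFunctionField = y := RationalMap.fromFunctionField_ofFunctionField ..
  have hdom : r.domain = ⊤ := by
    rw [eq_top_iff]
    intro x _
    have := hX x
    let x' : Spec (.of (X.presheaf.stalk x)) ⟶ X := X.fromSpecStalk x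
    let y' : Spec (.of X.functionField) ⟶ Y := y
    have h : y' ≫ π = Spec.map (CommRingCat.ofHom
        (algebraMap (X.presheaf.stalk x) X.functionField)) ≫ x' :=
      hy.trans (specMap_algebraMap_functionField x).symm
    obtain ⟨φ, hφy, hφ⟩ := exists_lift_of_isProper π y' x' h
    replace hφ : φ ≫ π = X.fromSpecStalk x ≫ 𝟙 X := by rw [hφ, Category.comp_id]
    -- The lift to the local ring at `x` spreads out to a partial map defined at `x`. It agrees with
    -- `r` at the generic point, hence represents `r`.
    refine RationalMap.mem_domain.mpr ⟨PartialMap.ofFromSpecStalk (𝟙 X) π φ hφ,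
      PartialMap.mem_domain_ofFromSpecStalk .., ?_⟩
    refine RationalMap.eq_of_fromFunctionField_eq _ _ ?_
    rw [hr, RationalMap.fromFunctionField_toRationalMap]
    rw [fromFunctionField_eq_comp _ (PartialMap.mem_domain_ofFromSpecStalk (𝟙 X) π φ hφ),
      PartialMap.fromSpecStalkOfMem_ofFromSpecStalk]
    exact hφy
  have h1 : r.toPartialMap.fromFunctionField = y := by
    rw [← hr]
    conv_rhs => rw [← r.toRationalMap_toPartialMap]
    rfl
  -- Composed with `π`, the map agrees with the identity at the generic point, and separatedness of
  -- `X` extends this to the whole domain.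
  have h2 : (r.toPartialMap.compHom π).equiv (𝟙 X : X ⟶ X).toPartialMap := by
    have hmem : genericPoint X ∈ r.toPartialMap.domain :=
      (genericPoint_specializes _).mem_open r.toPartialMap.domain.2
        r.toPartialMap.dense_domain.nonempty.choose_spec
    refine PartialMap.equiv_of_fromSpecStalkOfMem_eq _ _ (x := genericPoint X) hmem trivial ?_
    refine (PartialMap.fromSpecStalkOfMem_compHom _ _ _ _).trans ?_
    refine Eq.trans ?_ (PartialMap.fromSpecStalkOfMem_toPartialMap _ _).symm
    rw [Category.comp_id, ← hy, ← h1]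
  have h3 := (PartialMap.equiv_toPartialMap_iff_of_isSeparated (S := ⊤_ Scheme)).mp h2
  have h4 : IsIso r.toPartialMap.domain.ι := by
    have h5 : r.toPartialMap.domain = ⊤ := hdom
    rw [h5]
    exact (Scheme.topIso X).isIso_hom
  refine ⟨inv r.toPartialMap.domain.ι ≫ r.toPartialMap.hom, ?_⟩
  rw [Category.assoc, IsIso.inv_comp_eq]
  exact h3

end Extension

/-! ### Smooth curves -/

section Curve

open Polynomial

lemma isIso_fromSpec_of_subsingleton {X : Scheme.{0}} [Subsingleton X] {U : X.Opens}
    (hU : IsAffineOpen U) (hne : (U : Set X).Nonempty) : IsIso hU.fromSpec := by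
  refine isIso_of_isOpenImmersion_of_opensRange_eq_top _ ?_
  rw [hU.opensRange_fromSpec, eq_top_iff]
  rintro x -
  obtain ⟨y, hy⟩ := hne
  exact Subsingleton.elim y x ▸ hy

/-- A smooth curve over a field is locally étale over the affine line. -/
lemma exists_etale_of_smoothOfRelativeDimension_one {k : Type} [Field k] {X : Scheme.{0}}
    (f : X ⟶ Spec (.of k)) [SmoothOfRelativeDimension 1 f] (x : X) :
    ∃ (V : X.Opens) (hV : IsAffineOpen V) (_ : x ∈ V) (φ : k[X] →+* Γ(X, V)),
      φ.Etale ∧ Spec.map (CommRingCat.ofHom (φ.comp C)) = hV.fromSpec ≫ f := by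
  obtain ⟨U, hU, V, hV, hx, e, h⟩ :=
    SmoothOfRelativeDimension.exists_isStandardSmoothOfRelativeDimension (n := 1) (f := f) x
  obtain ⟨g, hg, hg'⟩ := h.exists_etale_mvPolynomial
  have : Subsingleton (Spec (.of k)) :=
    inferInstanceAs (Subsingleton (PrimeSpectrum k))
  have : IsIso hU.fromSpec := isIso_fromSpec_of_subsingleton hU ⟨_, e hx⟩
  let r : CommRingCat.of k ⟶ Γ(Spec (.of k), U) := Spec.preimage hU.fromSpec
  have hr : Spec.map r = hU.fromSpec := Spec.map_preimage _
  have hr' : IsIso r := by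
    have : IsIso (Scheme.Spec.map r.op) := (congrArg IsIso hr).mpr inferInstance
    have : IsIso r.op := isIso_of_reflects_iso r.op Scheme.Spec
    exact isIso_of_op r
  let r' : k ≃+* Γ(Spec (.of k), U) := (asIso r).commRingCatIsoToRingEquiv
  let θ : k[X] ≃+* MvPolynomial (Fin 1) Γ(Spec (.of k), U) :=
    (Polynomial.mapEquiv r').trans (MvPolynomial.uniqueAlgEquiv _ (Fin 1)).symm.toRingEquiv
  refine ⟨V, hV, hx, g.comp θ, RingHom.Etale.stableUnderComposition _ _
    (RingHom.Etale.of_bijective θ.bijective) hg', ?_⟩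
  have h1 : (g.comp θ.toRingHom).comp C = (f.appLE U V e).hom.comp r.hom := by
    rw [← hg]
    ext a
    simp only [RingHom.comp_apply]
    congr 1
    change (MvPolynomial.uniqueAlgEquiv _ (Fin 1)).symm (Polynomial.mapEquiv r' (C a)) = _
    rw [AlgEquiv.symm_apply_eq]
    simp [r']
    rfl
  have h2 : CommRingCat.ofHom ((g.comp θ.toRingHom).comp C) = r ≫ f.appLE U V e :=
    CommRingCat.hom_ext h1
  refine (congrArg Spec.map h2).trans ?_
  rw [Spec.map_comp, hr, IsAffineOpen.SpecMap_appLE_fromSpec]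

lemma valuationRing_stalk {k : Type} [Field k] {X : Scheme.{0}} [IsIntegral X]
    (f : X ⟶ Spec (.of k)) [SmoothOfRelativeDimension 1 f] (x : X) :
    ValuationRing (X.presheaf.stalk x) := by
  obtain ⟨V, hV, hx, φ, hφ, -⟩ := exists_etale_of_smoothOfRelativeDimension_one f x
  algebraize [φ]
  let := X.presheaf.algebra_section_stalk (⟨x, hx⟩ : V)
  have := hV.isLocalization_stalk ⟨x, hx⟩
  exact valuationRing_of_etale k[X] Γ(X, V) _ (hV.primeIdealOf ⟨x, hx⟩).asIdeal

/-- The embedding of the base field into the function field. -/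
def toFunctionField {k : Type} [Field k] {X : Scheme.{0}} [IrreducibleSpace X]
    (f : X ⟶ Spec (.of k)) : k →+* X.functionField :=
  (Spec.preimage (X.fromSpecStalk (genericPoint X) ≫ f)).hom

lemma specMap_toFunctionField {k : Type} [Field k] {X : Scheme.{0}} [IrreducibleSpace X]
    (f : X ⟶ Spec (.of k)) :
    Spec.map (CommRingCat.ofHom (toFunctionField f)) = X.fromSpecStalk (genericPoint X) ≫ f :=
  Spec.map_preimage _

lemma exists_poleFiltration_functionField {k : Type} [Field k] [CharZero k] {X : Scheme.{0}}
    [IsIntegral X] (f : X ⟶ Spec (.of k)) [SmoothOfRelativeDimension 1 f]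
    [Algebra k X.functionField] (h : algebraMap k X.functionField = toFunctionField f) :
    Nonempty (PoleFiltration k X.functionField) := by
  obtain ⟨V, hV, hx, φ, hφ, hφ'⟩ :=
    exists_etale_of_smoothOfRelativeDimension_one f (genericPoint X)
  algebraize [φ]
  have : Nonempty V := ⟨⟨_, hx⟩⟩
  have := functionField_isFractionRing_of_isAffineOpen X V hV
  refine exists_poleFiltration_of_etale (S := Γ(X, V)) ?_
  rw [h]
  have h1 : Spec.map (CommRingCat.ofHom (toFunctionField f)) =
      Spec.map (CommRingCat.ofHom (φ.comp C) ≫ X.presheaf.germ V (genericPoint X) hx) := by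
    rw [specMap_toFunctionField, Spec.map_comp, hφ', ← hV.fromSpecStalk_eq_fromSpecStalk hx,
      IsAffineOpen.fromSpecStalk, Category.assoc]
  exact congrArg CommRingCat.Hom.hom (Spec.map_injective h1)

end Curve

/-! ### Evaluation of functions at points with values in a ring -/

section Evaluation

/-- The value of a function on `U` at a point `P : Spec R ⟶ X` that lies in `U`. -/
def evalAt {R : Type} [CommRing R] {X : Scheme.{0}} (P : Spec (.of R) ⟶ X) (U : X.Opens)
    (h : ⊤ ≤ P ⁻¹ᵁ U) : Γ(X, U) →+* R :=
  (P.appLE U ⊤ h ≫ (Scheme.ΓSpecIso (.of R)).hom).hom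

variable {R R' : Type} [CommRing R] [CommRing R'] {X Y : Scheme.{0}}

lemma evalAt_res (P : Spec (.of R) ⟶ X) {U V : X.Opens} (hVU : V ≤ U) (h : ⊤ ≤ P ⁻¹ᵁ V)
    (a : Γ(X, U)) : evalAt P V h (res hVU a) =
      evalAt P U (h.trans ((TopologicalSpace.Opens.map P.base).monotone hVU)) a := by
  have h1 := Scheme.Hom.map_appLE P h (homOfLE hVU).op
  exact congrArg (Scheme.ΓSpecIso (.of R)).hom.hom congr($h1 a)

lemma evalAt_app (P : Spec (.of R) ⟶ X) (f : X ⟶ Y) (U : Y.Opens) (h : ⊤ ≤ P ⁻¹ᵁ f ⁻¹ᵁ U)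
    (a : Γ(Y, U)) : evalAt P (f ⁻¹ᵁ U) h ((f.app U).hom a) = evalAt (P ≫ f) U h a := by
  have h1 := Scheme.Hom.comp_appLE P f U ⊤ h
  exact (congrArg (Scheme.ΓSpecIso (.of R)).hom.hom congr($h1 a)).symm

lemma evalAt_specMap_comp (P : Spec (.of R) ⟶ X) (φ : R →+* R') (U : X.Opens) (h : ⊤ ≤ P ⁻¹ᵁ U)
    (h' : ⊤ ≤ (Spec.map (CommRingCat.ofHom φ) ≫ P) ⁻¹ᵁ U) (a : Γ(X, U)) :
    evalAt (Spec.map (CommRingCat.ofHom φ) ≫ P) U h' a = φ (evalAt P U h a) := by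
  have h1 := Scheme.Hom.appLE_comp_appLE (Spec.map (CommRingCat.ofHom φ)) P U ⊤ ⊤ h le_top
  have h2 : (Spec.map (CommRingCat.ofHom φ) ≫ P).appLE U ⊤ h' ≫ (Scheme.ΓSpecIso (.of R')).hom =
      P.appLE U ⊤ h ≫ (Scheme.ΓSpecIso (.of R)).hom ≫ CommRingCat.ofHom φ := by
    have h2 : (Spec.map (CommRingCat.ofHom φ)).appLE ⊤ ⊤ le_top =
        (Spec.map (CommRingCat.ofHom φ)).appTop := Scheme.Hom.appLE_eq_app _
    rw [← h1, Category.assoc, h2, Scheme.ΓSpecIso_naturality]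
  exact congr($h2 a)

lemma evalAt_congr {P Q : Spec (.of R) ⟶ X} (hPQ : P = Q) (U : X.Opens) (h : ⊤ ≤ P ⁻¹ᵁ U)
    (a : Γ(X, U)) : evalAt P U h a = evalAt Q U (hPQ ▸ h) a := by
  subst hPQ; rfl

lemma preimage_specMap_comp (P : Spec (.of R) ⟶ X) (φ : R →+* R') (U : X.Opens)
    (h : ⊤ ≤ P ⁻¹ᵁ U) : ⊤ ≤ (Spec.map (CommRingCat.ofHom φ) ≫ P) ⁻¹ᵁ U :=
  fun x _ => h (x := Spec.map (CommRingCat.ofHom φ) x) trivial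

end Evaluation

/-! ### Points of `Proj` -/

section ProjPoint

open HomogeneousLocalization

variable {A : Type} [CommRing A] {σ : Type} [SetLike σ A] [AddSubgroupClass σ A] (𝒜 : ℕ → σ)
  [GradedRing 𝒜] {R R' : Type} [CommRing R] [CommRing R']

/-- The map `a / f ^ n ↦ ψ a / ψ f ^ n`. -/
def awayLift {f : A} (ψ : A →+* R) (hf : IsUnit (ψ f)) : Away 𝒜 f →+* R :=
  (IsLocalization.Away.lift (S := Localization.Away f) f hf).comp
    (algebraMap (Away 𝒜 f) (Localization.Away f))

lemma awayLift_mul {f : A} (ψ : A →+* R) (hf : IsUnit (ψ f)) {d : ℕ} (hd : f ∈ 𝒜 d) (n : ℕ) (a : A)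
    (ha : a ∈ 𝒜 (n • d)) : awayLift 𝒜 ψ hf (Away.mk 𝒜 hd n a ha) * ψ f ^ n = ψ a := by
  have h1 : (Away.mk 𝒜 hd n a ha).val * algebraMap A (Localization.Away f) (f ^ n) =
      algebraMap A (Localization.Away f) a := by
    rw [Away.val_mk, Localization.mk_eq_mk']
    exact IsLocalization.mk'_spec (Localization.Away f) a
      (⟨f ^ n, n, rfl⟩ : Submonoid.powers f)
  have h2 := congrArg (IsLocalization.Away.lift (S := Localization.Away f) f hf) h1
  rw [map_mul, IsLocalization.Away.lift_eq, IsLocalization.Away.lift_eq, map_pow] at h2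
  exact h2

lemma awayLift_fromZeroRingHom {f : A} (ψ : A →+* R) (hf : IsUnit (ψ f)) (a : 𝒜 0) :
    awayLift 𝒜 ψ hf (fromZeroRingHom 𝒜 _ a) = ψ a := by
  have h1 : (fromZeroRingHom 𝒜 (Submonoid.powers f) a).val = algebraMap A (Localization.Away f) a := by
    rw [← Localization.mk_one_eq_algebraMap]; rfl
  have h2 := congrArg (IsLocalization.Away.lift (S := Localization.Away f) f hf) h1
  rw [IsLocalization.Away.lift_eq] at h2
  exact h2

lemma awayLift_comp_awayMap {f g x : A} {e : ℕ} (hg : g ∈ 𝒜 e) (hx : x = f * g)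
    (ψ : A →+* R) (hf : IsUnit (ψ f)) (hx' : IsUnit (ψ x)) :
    (awayLift 𝒜 ψ hx').comp (awayMap 𝒜 hg hx) = awayLift 𝒜 ψ hf := by
  have hf' : IsUnit (algebraMap A (Localization.Away x) f) :=
    isUnit_of_mul_isUnit_left (y := algebraMap A (Localization.Away x) g) (by
      rw [← map_mul, ← hx]; exact IsLocalization.Away.algebraMap_isUnit x)
  have h1 : (IsLocalization.Away.lift (S := Localization.Away x) x hx').comp
      (IsLocalization.Away.lift (S := Localization.Away f) f hf') =
      IsLocalization.Away.lift (S := Localization.Away f) f hf := by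
    refine IsLocalization.ringHom_ext (Submonoid.powers f) ?_
    ext a
    simp [IsLocalization.Away.lift_eq]
  ext z
  exact (congrArg (IsLocalization.Away.lift (S := Localization.Away x) x hx')
    (val_awayMap 𝒜 hg hx z)).trans congr($h1 z.val)

/-- The point of `Proj` with homogeneous coordinates `ψ`. -/
def projPoint {f : A} {d : ℕ} (hd : f ∈ 𝒜 d) (hd0 : 0 < d) (ψ : A →+* R) (hf : IsUnit (ψ f)) :
    Spec (.of R) ⟶ Proj 𝒜 :=
  Spec.map (CommRingCat.ofHom (awayLift 𝒜 ψ hf)) ≫ Proj.awayι 𝒜 f hd hd0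

/-- Both points factor through the chart where `f * g` is invertible. -/
lemma projPoint_eq {f g : A} {d e : ℕ} (hd : f ∈ 𝒜 d) (hd0 : 0 < d) (he : g ∈ 𝒜 e) (he0 : 0 < e)
    (ψ : A →+* R) (hf : IsUnit (ψ f)) (hg : IsUnit (ψ g)) :
    projPoint 𝒜 hd hd0 ψ hf = projPoint 𝒜 he he0 ψ hg := by
  have hfg : IsUnit (ψ (f * g)) := by rw [map_mul]; exact hf.mul hg
  rw [projPoint, projPoint, ← awayLift_comp_awayMap 𝒜 he rfl ψ hf hfg,
    ← awayLift_comp_awayMap 𝒜 hd (mul_comm f g) ψ hg hfg, CommRingCat.ofHom_comp,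
    CommRingCat.ofHom_comp, Spec.map_comp, Spec.map_comp, Category.assoc, Category.assoc,
    Proj.SpecMap_awayMap_awayι, Proj.SpecMap_awayMap_awayι]
  rfl

lemma top_le_preimage_basicOpen {f : A} {d : ℕ} (hd : f ∈ 𝒜 d) (hd0 : 0 < d)
    (χ : Away 𝒜 f →+* R) : ⊤ ≤ (Spec.map (CommRingCat.ofHom χ) ≫ Proj.awayι 𝒜 f hd hd0) ⁻¹ᵁ
      Proj.basicOpen 𝒜 f := by
  intro x _
  rw [← Proj.opensRange_awayι 𝒜 f hd hd0]
  exact ⟨Spec.map (CommRingCat.ofHom χ) x, rfl⟩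

/-- The global functions on the chart are identified with `Away 𝒜 f` in two directions, by
`awayToSection` and by pullback along `awayι`; these are mutually inverse. -/
lemma evalAt_awayι {f : A} {d : ℕ} (hd : f ∈ 𝒜 d) (hd0 : 0 < d) (χ : Away 𝒜 f →+* R)
    (z : Away 𝒜 f) : evalAt (Spec.map (CommRingCat.ofHom χ) ≫ Proj.awayι 𝒜 f hd hd0)
      (Proj.basicOpen 𝒜 f) (top_le_preimage_basicOpen 𝒜 hd hd0 χ)
        ((Proj.awayToSection 𝒜 f).hom z) = χ z := by
  have h0 : ⊤ ≤ Proj.awayι 𝒜 f hd hd0 ⁻¹ᵁ Proj.basicOpen 𝒜 f := by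
    intro x _
    rw [← Proj.opensRange_awayι 𝒜 f hd hd0]
    exact ⟨x, rfl⟩
  rw [evalAt_specMap_comp _ _ _ h0]
  congr 1
  have h1 : Proj.basicOpenToSpec 𝒜 f ≫ Proj.awayι 𝒜 f hd hd0 = (Proj.basicOpen 𝒜 f).ι := by
    rw [Proj.awayι, ← Proj.basicOpenIsoSpec_hom 𝒜 f hd hd0, Iso.hom_inv_id_assoc]
  let e : Γ(Proj 𝒜, Proj.basicOpen 𝒜 f) ⟶ CommRingCat.of (Away 𝒜 f) :=
    (Proj.awayι 𝒜 f hd hd0).appLE (Proj.basicOpen 𝒜 f) ⊤ h0 ≫ (Scheme.ΓSpecIso _).hom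
  have h2 : e ≫ Proj.awayToSection 𝒜 f = 𝟙 _ := by
    rw [← cancel_mono (Proj.basicOpen 𝒜 f).topIso.inv]
    have h3 := Scheme.Hom.appLE_comp_appLE (Proj.basicOpenToSpec 𝒜 f) (Proj.awayι 𝒜 f hd hd0)
      (Proj.basicOpen 𝒜 f) ⊤ ⊤ h0 le_top
    have h4 : (Proj.basicOpenToSpec 𝒜 f).appLE ⊤ ⊤ le_top = (Scheme.ΓSpecIso _).hom ≫
        Proj.awayToSection 𝒜 f ≫ (Proj.basicOpen 𝒜 f).topIso.inv := by
      rw [← Proj.basicOpenToSpec_app_top]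
      exact Scheme.Hom.appLE_eq_app _
    rw [h4] at h3
    rw [Category.id_comp, Category.assoc, Category.assoc, h3]
    simp only [h1]
    simp [Scheme.Hom.appLE]
    rfl
  have h5 : IsIso (Proj.awayToSection 𝒜 f) := (Proj.basicOpenIsoAway 𝒜 f hd hd0).isIso_hom
  have h6 : Proj.awayToSection 𝒜 f ≫ e = 𝟙 _ := by
    have h7 : e = inv (Proj.awayToSection 𝒜 f) := by
      simpa using (IsIso.eq_comp_inv (Proj.awayToSection 𝒜 f)).mpr h2
    rw [h7, IsIso.hom_inv_id]
  exact congr($h6 z)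

end ProjPoint

/-! ### The Grassmannian is proper -/

section Proper

lemma surjective_algebraMap_pluckerGrading_zero (p N : ℕ) :
    Function.Surjective (algebraMap ℂ (pluckerGrading p N 0)) := by
  rintro ⟨_, P, hP, rfl⟩
  have h1 : P.totalDegree = 0 := (MvPolynomial.totalDegree_zero_iff_isHomogeneous _).mpr hP
  rw [MvPolynomial.totalDegree_eq_zero_iff_eq_C] at h1
  refine ⟨MvPolynomial.coeff 0 P, Subtype.ext ?_⟩
  have h2 : algebraMap ℂ (PluckerRing p N) (MvPolynomial.coeff 0 P) =
      (pluckerMap p N).rangeRestrict P := by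
    conv_rhs => rw [h1]
    exact ((pluckerMap p N).rangeRestrict.commutes _).symm
  exact h2

/-- `Proj` of a finitely generated graded algebra is proper over the spectrum of its degree zero
part, and that spectrum is closed in `Spec ℂ` because the degree zero part consists of constants. -/
instance isProper_toSpec (p N : ℕ) : IsProper (Grassmannian.toSpec p N) := by
  have h1 : Algebra.FiniteType ℂ (PluckerRing p N) :=
    Algebra.FiniteType.of_surjective (pluckerMap p N).rangeRestrict
      (pluckerMap p N).rangeRestrict_surjective
  have h2 : IsScalarTower ℂ (pluckerGrading p N 0) (PluckerRing p N) :=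
    IsScalarTower.of_algebraMap_eq (R := ℂ) (S := pluckerGrading p N 0) (A := PluckerRing p N)
      fun _ => rfl
  have h3 : Algebra.FiniteType (pluckerGrading p N 0) (PluckerRing p N) :=
    .of_restrictScalars_finiteType ℂ _ _
  let f : CommRingCat.of ℂ ⟶ CommRingCat.of (pluckerGrading p N 0) :=
    CommRingCat.ofHom (algebraMap ℂ (pluckerGrading p N 0))
  have h4 : IsClosedImmersion (Spec.map f) :=
    IsClosedImmersion.spec_of_surjective f (surjective_algebraMap_pluckerGrading_zero p N)
  have h5 : IsProper (Proj.toSpecZero (pluckerGrading p N) ≫ Spec.map f) := inferInstance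
  exact h5

end Proper

/-! ### Points of the product of a curve with the Grassmannian -/

section Points

open HomogeneousLocalization TensorProduct

instance awayAlgebra (p N : ℕ) (I : PluckerIndex p N) :
    Algebra ℂ (Away (pluckerGrading p N) (coord p N I)) :=
  ((fromZeroRingHom (pluckerGrading p N) _).comp (algebraMap ℂ (pluckerGrading p N 0))).toAlgebra

/-- The map `a / x_I ^ n ↦ ψ a / ψ x_I ^ n`. -/
def awayLiftAlgHom {p N : ℕ} (I : PluckerIndex p N) {R : Type} [CommRing R] [Algebra ℂ R]
    (ψ : PluckerRing p N →ₐ[ℂ] R) (hI : IsUnit (ψ (coord p N I))) :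
    Away (pluckerGrading p N) (coord p N I) →ₐ[ℂ] R where
  __ := awayLift (pluckerGrading p N) (ψ : PluckerRing p N →+* R) hI
  commutes' z := by
    refine (awayLift_fromZeroRingHom (pluckerGrading p N) (ψ : PluckerRing p N →+* R) hI
      (algebraMap ℂ (pluckerGrading p N 0) z)).trans ?_
    exact ψ.commutes z

lemma awayLiftAlgHom_mul {p N : ℕ} (I : PluckerIndex p N) {R : Type} [CommRing R] [Algebra ℂ R]
    (ψ : PluckerRing p N →ₐ[ℂ] R) (hI : IsUnit (ψ (coord p N I))) (n : ℕ) (a : PluckerRing p N)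
    (ha : a ∈ pluckerGrading p N (n • 1)) :
    awayLiftAlgHom I ψ hI (Away.mk (pluckerGrading p N) (coord_mem p N I) n a ha) *
      ψ (coord p N I) ^ n = ψ a :=
  awayLift_mul (pluckerGrading p N) (ψ : PluckerRing p N →+* R) hI (coord_mem p N I) n a ha

/-- Functions on the chart `x_I ≠ 0` are quotients by powers of `x_I`. -/
lemma exists_mul_pow_eq {p N : ℕ} (I : PluckerIndex p N) {K : Type} [CommRing K] [Algebra ℂ K]
    (T : K ⊗[ℂ] Away (pluckerGrading p N) (coord p N I)) :
    ∃ (r : ℕ) (w : K ⊗[ℂ] PluckerRing p N),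
      w ∈ Submodule.span K {w | ∃ a ∈ pluckerGrading p N r, (1 : K) ⊗ₜ[ℂ] a = w} ∧
      ∀ {R : Type} [CommRing R] [Algebra ℂ R] (α : K →ₐ[ℂ] R) (ψ : PluckerRing p N →ₐ[ℂ] R)
        (hI : IsUnit (ψ (coord p N I))),
        Algebra.TensorProduct.lift α (awayLiftAlgHom I ψ hI) (fun _ _ => .all _ _) T *
          ψ (coord p N I) ^ r = Algebra.TensorProduct.lift α ψ (fun _ _ => .all _ _) w := by
  induction T with
  | zero => exact ⟨0, 0, Submodule.zero_mem _, fun α ψ hI => by simp⟩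
  | tmul κ z =>
    obtain ⟨r, a, ha, rfl⟩ := Away.mk_surjective (pluckerGrading p N) (coord_mem p N I) z
    refine ⟨r, κ ⊗ₜ a, ?_, fun α ψ hI => ?_⟩
    · have h1 : κ ⊗ₜ[ℂ] a = κ • ((1 : K) ⊗ₜ[ℂ] a) := by
        rw [TensorProduct.smul_tmul', smul_eq_mul, mul_one]
      rw [h1]
      exact Submodule.smul_mem _ _ (Submodule.subset_span ⟨a, by simpa using ha, rfl⟩)
    · rw [Algebra.TensorProduct.lift_tmul, Algebra.TensorProduct.lift_tmul, mul_assoc,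
        awayLiftAlgHom_mul]
  | add T T' hT hT' =>
    obtain ⟨r, w, hw, h⟩ := hT
    obtain ⟨r', w', hw', h'⟩ := hT'
    have key : ∀ (r r' : ℕ) (w : K ⊗[ℂ] PluckerRing p N),
        w ∈ Submodule.span K {w | ∃ a ∈ pluckerGrading p N r, (1 : K) ⊗ₜ[ℂ] a = w} →
        w * (1 ⊗ₜ coord p N I) ^ r' ∈
          Submodule.span K {w | ∃ a ∈ pluckerGrading p N (r + r'), (1 : K) ⊗ₜ[ℂ] a = w} := by
      intro r r' w hw
      induction hw using Submodule.span_induction with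
      | mem w hw =>
        obtain ⟨a, ha, rfl⟩ := hw
        refine Submodule.subset_span ⟨a * coord p N I ^ r', SetLike.mul_mem_graded ha ?_, by simp⟩
        simpa using SetLike.pow_mem_graded r' (coord_mem p N I)
      | zero => rw [zero_mul]; exact Submodule.zero_mem _
      | add x y _ _ hx hy => rw [add_mul]; exact Submodule.add_mem _ hx hy
      | smul c x _ hx => rw [smul_mul_assoc]; exact Submodule.smul_mem _ _ hx
    refine ⟨r + r', w * (1 ⊗ₜ coord p N I) ^ r' + w' * (1 ⊗ₜ coord p N I) ^ r,
      Submodule.add_mem _ (key r r' w hw) (add_comm r' r ▸ key r' r w' hw'), fun α ψ hI => ?_⟩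
    simp only [map_add, map_mul, ← h α ψ hI, ← h' α ψ hI, map_pow, Algebra.TensorProduct.lift_tmul,
      map_one, one_mul]
    ring

end Points

/-! ### Values of sections at points over the function field -/

section Values

open HomogeneousLocalization TensorProduct

variable {p N : ℕ} {B : Scheme.{0}} [IrreducibleSpace B] {b : B ⟶ Spec (.of ℂ)}
  [Algebra ℂ B.functionField] (hK : algebraMap ℂ B.functionField = toFunctionField b)
  {R R' : Type} [CommRing R] [Algebra ℂ R] [CommRing R'] [Algebra ℂ R']

/-- The generic point of `B`, with values in an algebra over the function field. -/
def genericPointMap (α : B.functionField →ₐ[ℂ] R) : Spec (.of R) ⟶ B :=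
  Spec.map (CommRingCat.ofHom (α : B.functionField →+* R)) ≫ B.fromSpecStalk (genericPoint B)

include hK in
lemma genericPointMap_comp (α : B.functionField →ₐ[ℂ] R) :
    genericPointMap α ≫ b = Spec.map (CommRingCat.ofHom (algebraMap ℂ R)) := by
  rw [genericPointMap, Category.assoc, ← specMap_toFunctionField, ← Spec.map_comp,
    ← CommRingCat.ofHom_comp, ← hK, α.comp_algebraMap]

/-- The point of the Grassmannian in the chart `x_I ≠ 0` given by `χ`. -/
def chartMap (I : PluckerIndex p N) (χ : Away (pluckerGrading p N) (coord p N I) →ₐ[ℂ] R) :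
    Spec (.of R) ⟶ Grassmannian p N :=
  Spec.map (CommRingCat.ofHom (χ : Away (pluckerGrading p N) (coord p N I) →+* R)) ≫
    Proj.awayι (pluckerGrading p N) (coord p N I) (coord_mem p N I) one_pos

lemma chartMap_toSpec (I : PluckerIndex p N)
    (χ : Away (pluckerGrading p N) (coord p N I) →ₐ[ℂ] R) :
    chartMap I χ ≫ Grassmannian.toSpec p N = Spec.map (CommRingCat.ofHom (algebraMap ℂ R)) := by
  rw [chartMap, Grassmannian.toSpec, Category.assoc, Proj.awayι_toSpecZero_assoc, ← Spec.map_comp,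
    ← Spec.map_comp, ← CommRingCat.ofHom_comp, ← CommRingCat.ofHom_comp]
  congr 2
  exact χ.comp_algebraMap

/-- The point of `B × G` over the generic point of `B` in the chart `x_I ≠ 0` given by `χ`. -/
def chartPoint (I : PluckerIndex p N) (α : B.functionField →ₐ[ℂ] R)
    (χ : Away (pluckerGrading p N) (coord p N I) →ₐ[ℂ] R) : Spec (.of R) ⟶ prodGr b p N :=
  Limits.pullback.lift (genericPointMap α) (chartMap I χ)
    ((genericPointMap_comp hK α).trans (chartMap_toSpec I χ).symm)

lemma chartPoint_fst (I : PluckerIndex p N) (α : B.functionField →ₐ[ℂ] R)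
    (χ : Away (pluckerGrading p N) (coord p N I) →ₐ[ℂ] R) :
    chartPoint hK I α χ ≫ prodGr.fst b p N = genericPointMap α :=
  Limits.pullback.lift_fst _ _ _

lemma chartPoint_snd (I : PluckerIndex p N) (α : B.functionField →ₐ[ℂ] R)
    (χ : Away (pluckerGrading p N) (coord p N I) →ₐ[ℂ] R) :
    chartPoint hK I α χ ≫ prodGr.snd b p N = chartMap I χ :=
  Limits.pullback.lift_snd _ _ _

lemma specMap_comp_chartPoint (I : PluckerIndex p N) (α : B.functionField →ₐ[ℂ] R)
    (χ : Away (pluckerGrading p N) (coord p N I) →ₐ[ℂ] R) (φ : R →ₐ[ℂ] R') :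
    Spec.map (CommRingCat.ofHom (φ : R →+* R')) ≫ chartPoint hK I α χ =
      chartPoint hK I (φ.comp α) (φ.comp χ) := by
  apply Limits.pullback.hom_ext
  · rw [Category.assoc]
    refine (congrArg _ (chartPoint_fst hK I α χ)).trans
      (Eq.trans ?_ (chartPoint_fst hK I (φ.comp α) (φ.comp χ)).symm)
    rw [genericPointMap, genericPointMap, ← Category.assoc, ← Spec.map_comp]
    rfl
  · rw [Category.assoc]
    refine (congrArg _ (chartPoint_snd hK I α χ)).trans
      (Eq.trans ?_ (chartPoint_snd hK I (φ.comp α) (φ.comp χ)).symm)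
    rw [chartMap, chartMap, ← Category.assoc, ← Spec.map_comp]
    rfl

lemma chartPoint_awayLift_eq (I J : PluckerIndex p N) (α : B.functionField →ₐ[ℂ] R)
    (ψ : PluckerRing p N →ₐ[ℂ] R) (hI : IsUnit (ψ (coord p N I))) (hJ : IsUnit (ψ (coord p N J))) :
    chartPoint hK I α (awayLiftAlgHom I ψ hI) = chartPoint hK J α (awayLiftAlgHom J ψ hJ) := by
  apply Limits.pullback.hom_ext
  · exact (chartPoint_fst hK I α _).trans (chartPoint_fst hK J α _).symm
  · refine (chartPoint_snd hK I α _).trans (Eq.trans ?_ (chartPoint_snd hK J α _).symm)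
    exact projPoint_eq (pluckerGrading p N) (coord_mem p N I) one_pos (coord_mem p N J) one_pos
      (ψ : PluckerRing p N →+* R) hI hJ

lemma top_le_preimage_genericPointMap (α : B.functionField →ₐ[ℂ] R) {U : B.Opens}
    (hU : genericPoint B ∈ U) : ⊤ ≤ genericPointMap α ⁻¹ᵁ U := by
  intro x _
  have h1 : genericPointMap α x ∈ Set.range (B.fromSpecStalk (genericPoint B)) :=
    ⟨Spec.map (CommRingCat.ofHom (α : B.functionField →+* R)) x, rfl⟩
  rw [Scheme.range_fromSpecStalk] at h1
  exact h1.mem_open U.2 hU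

lemma top_le_preimage_chartMap (I : PluckerIndex p N)
    (χ : Away (pluckerGrading p N) (coord p N I) →ₐ[ℂ] R) :
    ⊤ ≤ chartMap I χ ⁻¹ᵁ Proj.basicOpen (pluckerGrading p N) (coord p N I) :=
  top_le_preimage_basicOpen (pluckerGrading p N) (coord_mem p N I) one_pos _

variable {k : ℕ} {L : LineBundle B}

lemma top_le_preimage_chartPoint (k : ℕ) (I : PluckerIndex p N) (α : B.functionField →ₐ[ℂ] R)
    (χ : Away (pluckerGrading p N) (coord p N I) →ₐ[ℂ] R) {i : L.ι} (hi : genericPoint B ∈ L.U i) :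
    ⊤ ≤ chartPoint hK I α χ ⁻¹ᵁ (twist b p N k L).U (I, i) := by
  have h1 := top_le_preimage_genericPointMap α hi
  have h2 := top_le_preimage_chartMap I χ
  rw [← chartPoint_fst hK I α χ] at h1
  rw [← chartPoint_snd hK I α χ] at h2
  exact fun x hx => ⟨h2 hx, h1 hx⟩

/-- The value of a section of `𝒪_G(k) ⊗ L` at a point over the generic point of `B`. -/
def sectionValue (s : (twist b p N k L).GlobalSection) {i : L.ι} (hi : genericPoint B ∈ L.U i)
    (I : PluckerIndex p N) (α : B.functionField →ₐ[ℂ] R)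
    (χ : Away (pluckerGrading p N) (coord p N I) →ₐ[ℂ] R) : R :=
  evalAt (chartPoint hK I α χ) ((twist b p N k L).U (I, i))
    (top_le_preimage_chartPoint hK k I α χ hi) (s.s (I, i))

/-- Naturality in the coefficient ring: the value at the universal point of a chart determines the
value at every other point. -/
lemma sectionValue_comp (s : (twist b p N k L).GlobalSection) {i : L.ι}
    (hi : genericPoint B ∈ L.U i) (I : PluckerIndex p N) (α : B.functionField →ₐ[ℂ] R)
    (χ : Away (pluckerGrading p N) (coord p N I) →ₐ[ℂ] R) (φ : R →ₐ[ℂ] R') :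
    sectionValue hK s hi I (φ.comp α) (φ.comp χ) = φ (sectionValue hK s hi I α χ) := by
  have h1 := specMap_comp_chartPoint hK I α χ φ
  have h2 := top_le_preimage_chartPoint hK k I α χ hi
  refine Eq.trans ?_ (evalAt_specMap_comp (chartPoint hK I α χ) (φ : R →+* R') _ h2
    (preimage_specMap_comp _ _ _ h2) (s.s (I, i)))
  exact (evalAt_congr h1 _ _ _).symm

lemma evalAt_pluckerBundle_g (I J : PluckerIndex p N)
    (χ : Away (pluckerGrading p N) (coord p N I) →ₐ[ℂ] R)
    (h : ⊤ ≤ chartMap I χ ⁻¹ᵁ ((pluckerBundle p N).U I ⊓ (pluckerBundle p N).U J)) :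
    evalAt (chartMap I χ) _ h ((pluckerBundle p N).g I J) =
      χ (Away.mk (pluckerGrading p N) (coord_mem p N I) 1 (coord p N J)
        (by simpa using coord_mem p N J)) :=
  (evalAt_res _ _ _ _).trans (evalAt_awayι _ (coord_mem p N I) one_pos _ _)

omit [Algebra ℂ R] in
lemma evalAt_res_app_pow_mul {X Y Z : Scheme.{0}} (P : Spec (.of R) ⟶ X) (f : X ⟶ Y) (g : X ⟶ Z)
    {W : X.Opens} {V : Y.Opens} {V' : Z.Opens} (h : ⊤ ≤ P ⁻¹ᵁ W) (hV : W ≤ f ⁻¹ᵁ V)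
    (hV' : W ≤ g ⁻¹ᵁ V') (a : Γ(Y, V)) {a' : Γ(Z, V')} (ha' : a' = 1) (k : ℕ) :
    evalAt P W h (res hV ((f.app V).hom (a ^ k)) * res hV' ((g.app V').hom a')) =
      evalAt (P ≫ f) V (h.trans fun _ hx => hV hx) a ^ k := by
  rw [ha', map_one, map_one, mul_one, evalAt_res, map_pow, map_pow, evalAt_app]

omit [IrreducibleSpace B] [Algebra ℂ B.functionField] in
lemma evalAt_twist_g {I J : PluckerIndex p N} {ψ : PluckerRing p N →ₐ[ℂ] R}
    {hI : IsUnit (ψ (coord p N I))} (P : Spec (.of R) ⟶ prodGr b p N)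
    (hP : P ≫ prodGr.snd b p N = chartMap I (awayLiftAlgHom I ψ hI)) (i : L.ι)
    (h : ⊤ ≤ P ⁻¹ᵁ ((twist b p N k L).U (I, i) ⊓ (twist b p N k L).U (J, i))) :
    evalAt P _ h ((twist b p N k L).g (I, i) (J, i)) * ψ (coord p N I) ^ k =
      ψ (coord p N J) ^ k := by
  have h7 := awayLiftAlgHom_mul I ψ hI 1 (coord p N J) (by simpa using coord_mem p N J)
  rw [pow_one] at h7
  rw [← h7, mul_pow]
  congr 1
  have h8 := evalAt_res_app_pow_mul P (prodGr.snd b p N) (prodGr.fst b p N) h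
    (V := (pluckerBundle p N).U I ⊓ (pluckerBundle p N).U J) (V' := L.U i ⊓ L.U i)
    (inf_le_inf inf_le_left inf_le_left) (inf_le_inf inf_le_right inf_le_right)
    ((pluckerBundle p N).g I J) (L.g_self i) k
  rw [evalAt_congr hP, evalAt_pluckerBundle_g] at h8
  exact h8

/-- The transition function of `𝒪_G(k)` is `(x_J / x_I) ^ k`, and that of `L` is `1` because the
same trivialization `i` is used in both charts. -/
lemma sectionValue_mul_pow (s : (twist b p N k L).GlobalSection) {i : L.ι}
    (hi : genericPoint B ∈ L.U i) (I J : PluckerIndex p N) (α : B.functionField →ₐ[ℂ] R)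
    (ψ : PluckerRing p N →ₐ[ℂ] R) (hI : IsUnit (ψ (coord p N I))) (hJ : IsUnit (ψ (coord p N J))) :
    sectionValue hK s hi I α (awayLiftAlgHom I ψ hI) * ψ (coord p N I) ^ k =
      sectionValue hK s hi J α (awayLiftAlgHom J ψ hJ) * ψ (coord p N J) ^ k := by
  set P := chartPoint hK I α (awayLiftAlgHom I ψ hI) with hP
  have hPJ : chartPoint hK J α (awayLiftAlgHom J ψ hJ) = P :=
    chartPoint_awayLift_eq hK J I α ψ hJ hI
  have hUI : ⊤ ≤ P ⁻¹ᵁ (twist b p N k L).U (I, i) := top_le_preimage_chartPoint hK k I α _ hi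
  have hUJ : ⊤ ≤ P ⁻¹ᵁ (twist b p N k L).U (J, i) :=
    hPJ ▸ top_le_preimage_chartPoint hK k J α _ hi
  have hU : ⊤ ≤ P ⁻¹ᵁ ((twist b p N k L).U (I, i) ⊓ (twist b p N k L).U (J, i)) :=
    fun x hx => ⟨hUI hx, hUJ hx⟩
  have h1 := congrArg (evalAt P _ hU) (s.compat (I, i) (J, i))
  rw [map_mul, evalAt_res, evalAt_res] at h1
  have h2 : sectionValue hK s hi J α (awayLiftAlgHom J ψ hJ) = evalAt P _ hUJ (s.s (J, i)) :=
    evalAt_congr hPJ _ _ _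
  have h3 : sectionValue hK s hi I α (awayLiftAlgHom I ψ hI) = evalAt P _ hUI (s.s (I, i)) := rfl
  have h4 : evalAt P _ hU ((twist b p N k L).g (I, i) (J, i)) * ψ (coord p N I) ^ k =
      ψ (coord p N J) ^ k :=
    evalAt_twist_g P (chartPoint_snd hK I α _) i hU
  rw [h2, h3, h1, mul_right_comm, h4, mul_comm]

end Values

/-! ### Distinct minors are relatively prime -/

section RelPrime

open MvPolynomial

lemma vars_subset_of_dvd {K σ : Type*} [Field K] {d f : MvPolynomial σ K} (hdf : d ∣ f)
    (hf : f ≠ 0) : d.vars ⊆ f.vars := by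
  obtain ⟨e, rfl⟩ := hdf
  intro v hv
  rw [mem_vars_iff_degreeOf_ne_zero] at hv ⊢
  rw [degreeOf_mul_eq (left_ne_zero_of_mul hf) (right_ne_zero_of_mul hf)]
  omega

lemma minorOver_ne_zero (K : Type*) [Field K] (p N : ℕ) (I : PluckerIndex p N) :
    minorOver K p N I ≠ 0 := by
  intro h0
  have h1 := congrArg (eval fun v : Fin (p + 1) × Fin (N + 1) => if I v.1 = v.2 then (1 : K) else 0)
    h0
  rw [minorOver, RingHom.map_det, map_zero] at h1
  have h2 : (eval fun v : Fin (p + 1) × Fin (N + 1) =>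
      if I v.1 = v.2 then (1 : K) else 0).mapMatrix (Matrix.of fun i j => X (i, I j)) = 1 := by
    ext i j
    simp [Matrix.one_apply]
  rw [h2, Matrix.det_one] at h1
  exact one_ne_zero h1

lemma det_mem_of_forall_mem {R A : Type*} [CommRing R] [CommRing A] [Algebra R A]
    (S : Subalgebra R A) {n : ℕ} (M : Matrix (Fin n) (Fin n) A) (hM : ∀ i j, M i j ∈ S) :
    M.det ∈ S := by
  have h1 : M = S.val.mapMatrix (Matrix.of fun i j => (⟨M i j, hM i j⟩ : S)) := by
    ext i j; rfl
  rw [h1, ← AlgHom.map_det]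
  exact Subtype.prop _

lemma minorOver_mem_supported (K : Type*) [Field K] (p N : ℕ) (I : PluckerIndex p N) :
    minorOver K p N I ∈ supported K {v | v.2 ∈ Set.range I} :=
  det_mem_of_forall_mem _ _ fun i j => Algebra.subset_adjoin ⟨(i, I j), ⟨j, rfl⟩, rfl⟩

/-- A common divisor `d` involves only columns in `J`, so not column `I 0`. Specializing that column
to the `i`-th unit vector fixes `d` and turns the minor of `I` into, up to sign, a smaller minor
without row `i`. Hence `d` involves no variable of row `i`, for any `i`, and is constant. -/
lemma isRelPrime_minorOver (K : Type*) [Field K] (p N : ℕ) {I J : PluckerIndex p N}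
    (hIJ : I 0 ∉ Set.range J) : IsRelPrime (minorOver K p N I) (minorOver K p N J) := by
  classical
  intro d hdI hdJ
  have h1 : (d.vars : Set (Fin (p + 1) × Fin (N + 1))) ⊆ {v | v.2 ∈ Set.range J} :=
    (Finset.coe_subset.mpr (vars_subset_of_dvd hdJ (minorOver_ne_zero K p N J))).trans
      (mem_supported.mp (minorOver_mem_supported K p N J))
  have h2 : ∀ i : Fin (p + 1), ∀ v ∈ d.vars, v.1 ≠ i := by
    intro i
    let φ : MvPolynomial (Fin (p + 1) × Fin (N + 1)) K →ₐ[K]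
        MvPolynomial (Fin (p + 1) × Fin (N + 1)) K :=
      aeval fun v => if v.2 = I 0 then (if v.1 = i then 1 else 0) else X v
    have h3 : φ d = d := by
      refine hom_congr_vars (f₁ := φ.toRingHom) (f₂ := RingHom.id _) ?_ ?_ rfl
      · ext r; simp [φ]
      · intro v hv _
        have h4 : v.2 ≠ I 0 := fun h => hIJ (h ▸ h1 hv)
        simp [φ, h4]
    have hφ : φ (minorOver K p N I) = (-1) ^ (i : ℕ) *
        (Matrix.of fun a b : Fin p => (X (i.succAbove a, I b.succ) :
          MvPolynomial (Fin (p + 1) × Fin (N + 1)) K)).det := by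
      rw [minorOver, AlgHom.map_det, Matrix.det_succ_column_zero, Finset.sum_eq_single i]
      · have h5 : φ (X (i, I 0)) = 1 := by simp [φ]
        rw [AlgHom.mapMatrix_apply, Matrix.map_apply, Matrix.of_apply, h5, mul_one]
        congr 2
        ext1 a b
        have h6 : I b.succ ≠ I 0 := fun h => Fin.succ_ne_zero b (I.injective h)
        simp [φ, h6]
      · intro j _ hj
        simp [φ, hj]
      · simp
    have h7 : d ∣ φ (minorOver K p N I) := by
      conv_lhs => rw [← h3]
      exact map_dvd φ hdI
    have h8 : d ∣ (Matrix.of fun a b : Fin p => (X (i.succAbove a, I b.succ) :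
          MvPolynomial (Fin (p + 1) × Fin (N + 1)) K)).det := by
      rw [hφ] at h7
      exact ((isUnit_one.neg.pow _).dvd_mul_left).mp h7
    have h9 : (Matrix.of fun a b : Fin p => (X (i.succAbove a, I b.succ) :
          MvPolynomial (Fin (p + 1) × Fin (N + 1)) K)).det ≠ 0 := by
      intro h0
      let e : MvPolynomial (Fin (p + 1) × Fin (N + 1)) K →+* K := eval fun v =>
        if ∃ a : Fin p, v = (i.succAbove a, I a.succ) then 1 else 0
      have h10 := congrArg e h0
      rw [RingHom.map_det, map_zero] at h10
      have h11 : e.mapMatrix (Matrix.of fun a b : Fin p => X (i.succAbove a, I b.succ)) = 1 := by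
        ext a b
        have h12 : (∃ c : Fin p, i.succAbove a = i.succAbove c ∧ b = c) ↔ a = b :=
          ⟨fun ⟨c, hc, hb⟩ => (Fin.succAbove_right_injective hc).trans hb.symm,
            fun h => ⟨b, by rw [h], rfl⟩⟩
        simp only [e, RingHom.mapMatrix_apply, Matrix.map_apply, Matrix.of_apply, eval_X,
          Prod.mk.injEq, EmbeddingLike.apply_eq_iff_eq, Fin.succ_inj, h12, Matrix.one_apply]
      rw [h11, Matrix.det_one] at h10
      exact one_ne_zero h10
    have h13 : (Matrix.of fun a b : Fin p => (X (i.succAbove a, I b.succ) :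
          MvPolynomial (Fin (p + 1) × Fin (N + 1)) K)).det ∈ supported K {v | v.1 ≠ i} :=
      det_mem_of_forall_mem _ _ fun a b =>
        Algebra.subset_adjoin ⟨_, Fin.succAbove_ne i a, rfl⟩
    exact fun v hv => mem_supported.mp h13 (vars_subset_of_dvd h8 h9 hv)
  have h3 : d.vars = ∅ := Finset.eq_empty_of_forall_notMem fun v hv => h2 v.1 v hv rfl
  rw [vars_eq_empty_iff_eq_C] at h3
  rw [h3]
  refine (isUnit_iff_ne_zero.mpr fun h0 => ?_).map C
  rw [h0, C_0] at h3
  rw [h3, zero_dvd_iff] at hdI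
  exact minorOver_ne_zero K p N I hdI

/-- The columns `0, …, p` and `1, …, p + 1`: they may overlap, but only the first column of `I` has
to avoid `J`. -/
lemma exists_disjoint_pluckerIndex {p N : ℕ} (hpN : p < N) :
    ∃ I J : PluckerIndex p N, I 0 ∉ Set.range J := by
  refine ⟨Fin.castLEOrderEmb (by omega), (Fin.castLEOrderEmb (by omega)).trans
    (Fin.succOrderEmb N), ?_⟩
  rintro ⟨j, hj⟩
  exact Fin.succ_ne_zero _ (hj.trans (Fin.ext (by simp)))

lemma isHomogeneous_of_mul {K σ : Type*} [Field K] {f g : MvPolynomial σ K} {a e : ℕ}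
    (hf : f.IsHomogeneous a) (hf0 : f ≠ 0) (hfg : (f * g).IsHomogeneous (a + e)) :
    g.IsHomogeneous e := by
  have h1 : ∀ m, m ≠ e → homogeneousComponent m g = 0 := fun m hm => by
    have h2 := homogeneousComponent_mul_of_isHomogeneous hf g (a + m)
    rw [if_pos (by omega), Nat.add_sub_cancel_left, homogeneousComponent_of_mem hfg,
      if_neg (by omega)] at h2
    exact (mul_eq_zero.mp h2.symm).resolve_left hf0
  have h3 : g = homogeneousComponent e g := by
    conv_lhs => rw [← sum_homogeneousComponent g]
    by_cases he : e ∈ Finset.range (g.totalDegree + 1)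
    · exact Finset.sum_eq_single_of_mem e he fun m _ hm => h1 m hm
    · rw [homogeneousComponent_eq_zero e g (by simpa using he)]
      exact Finset.sum_eq_zero fun m hm => h1 m fun h => he (h ▸ hm)
  rw [h3]
  exact homogeneousComponent_isHomogeneous e g

/-- A fraction with two relatively prime denominators is integral. -/
lemma exists_algebraMap_eq_of_isRelPrime {A E : Type*} [CommRing A] [IsDomain A]
    [UniqueFactorizationMonoid A] [Field E] [Algebra A E] [IsFractionRing A E] {x y : A}
    (hxy : IsRelPrime x y) (hx : x ≠ 0) {v : E} {a b : A} (r s : ℕ)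
    (ha : v * algebraMap A E x ^ r = algebraMap A E a)
    (hb : v * algebraMap A E y ^ s = algebraMap A E b) : ∃ f : A, algebraMap A E f = v := by
  have h1 : a * y ^ s = b * x ^ r := by
    apply IsFractionRing.injective A E
    simp only [map_mul, map_pow, ← ha, ← hb]
    ring
  have h2 : x ^ r ∣ a := (hxy.pow (m := r) (n := s)).dvd_of_dvd_mul_right (h1 ▸ ⟨b, mul_comm _ _⟩)
  obtain ⟨f, rfl⟩ := h2
  refine ⟨f, ?_⟩
  have h3 : algebraMap A E x ^ r ≠ 0 :=
    pow_ne_zero _ fun h => hx ((map_eq_zero_iff _ (IsFractionRing.injective A E)).mp h)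
  rw [map_mul, map_pow, mul_comm v] at ha
  exact (mul_left_cancel₀ h3 ha).symm

end RelPrime

/-! ### Sections over the generic point are polynomials in the matrix entries -/

section Polynomial

open HomogeneousLocalization TensorProduct MvPolynomial

section Ring

variable (p N : ℕ) (K : Type) [CommRing K] [Algebra ℂ K]

/-- The Plücker ring inside the polynomial ring over a field extension. -/
def pluckerToPolynomial :
    PluckerRing p N →ₐ[ℂ] MvPolynomial (Fin (p + 1) × Fin (N + 1)) K :=
  (mapAlgHom (Algebra.ofId ℂ K)).comp (pluckerMap p N).range.val

lemma pluckerToPolynomial_coord (I : PluckerIndex p N) :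
    pluckerToPolynomial p N K (coord p N I) = minorOver K p N I := by
  have h1 : ((coord p N I : PluckerRing p N) : MvPolynomial _ ℂ) = minor p N I :=
    aeval_X _ _
  have h2 := map_minorOver (algebraMap ℂ K) p N I
  refine Eq.trans ?_ h2
  exact congrArg (map (algebraMap ℂ K)) h1

lemma pluckerToPolynomial_isHomogeneous {n : ℕ} {a : PluckerRing p N}
    (ha : a ∈ pluckerGrading p N n) :
    (pluckerToPolynomial p N K a).IsHomogeneous ((p + 1) * n) :=
  (val_mem_of_mem_pluckerGrading p N n ha).map (algebraMap ℂ K)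

lemma pluckerToPolynomial_mem {Q : Subalgebra K (MvPolynomial (Fin (p + 1) × Fin (N + 1)) K)}
    (hQ : ∀ I, minorOver K p N I ∈ Q) (a : PluckerRing p N) : pluckerToPolynomial p N K a ∈ Q := by
  obtain ⟨_, P, rfl⟩ := a
  have h1 : (pluckerToPolynomial p N K).comp (pluckerMap p N).rangeRestrict =
      (Q.restrictScalars ℂ).val.comp
        (aeval fun I => (⟨minorOver K p N I, hQ I⟩ : Q.restrictScalars ℂ)) := by
    ext I : 1
    refine (pluckerToPolynomial_coord p N K I).trans ?_
    rw [AlgHom.comp_apply, aeval_X]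
    rfl
  have h2 := congr($h1 P)
  refine Eq.mpr (congrArg (· ∈ Q) h2) (Subtype.prop _)

/-- Polynomials over `K` in the Plücker coordinates. -/
abbrev pluckerEval : K ⊗[ℂ] PluckerRing p N →ₐ[ℂ] MvPolynomial (Fin (p + 1) × Fin (N + 1)) K :=
  Algebra.TensorProduct.lift (IsScalarTower.toAlgHom ℂ K _) (pluckerToPolynomial p N K)
    (fun _ _ => .all _ _)

lemma pluckerEval_isHomogeneous {n : ℕ} {w : K ⊗[ℂ] PluckerRing p N}
    (hw : w ∈ Submodule.span K {w | ∃ a ∈ pluckerGrading p N n, (1 : K) ⊗ₜ[ℂ] a = w}) :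
    (pluckerEval p N K w).IsHomogeneous ((p + 1) * n) := by
  induction hw using Submodule.span_induction with
  | mem w hw =>
    obtain ⟨a, ha, rfl⟩ := hw
    rw [Algebra.TensorProduct.lift_tmul, map_one, one_mul]
    exact pluckerToPolynomial_isHomogeneous p N K ha
  | zero => rw [map_zero]; exact isHomogeneous_zero _ _ _
  | add x y _ _ hx hy => rw [map_add]; exact hx.add hy
  | smul c x _ hx =>
    have h1 : c • x = (c ⊗ₜ[ℂ] (1 : PluckerRing p N)) * x :=
      Algebra.smul_def c x
    rw [h1, map_mul, Algebra.TensorProduct.lift_tmul, map_one, mul_one]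
    have h2 := (isHomogeneous_C (Fin (p + 1) × Fin (N + 1)) c).mul hx
    rw [zero_add] at h2
    exact h2

end Ring

variable {p N : ℕ} {B : Scheme.{0}} [IsIntegral B] {b : B ⟶ Spec (.of ℂ)}
  [Algebra ℂ B.functionField] (hK : algebraMap ℂ B.functionField = toFunctionField b)
  {k : ℕ} {L : LineBundle B}

/-- Evaluate once at the universal point with values in `K ⊗ Away` and specialize; this makes `r`
and `w` independent of `R`, `α` and `ψ`. -/
lemma exists_sectionValue_mul_pow_eq (s : (twist b p N k L).GlobalSection) {i : L.ι}
    (hi : genericPoint B ∈ L.U i) (I : PluckerIndex p N) :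
    ∃ (r : ℕ) (w : B.functionField ⊗[ℂ] PluckerRing p N),
      w ∈ Submodule.span B.functionField
        {w | ∃ a ∈ pluckerGrading p N r, (1 : B.functionField) ⊗ₜ[ℂ] a = w} ∧
      ∀ {R : Type} [CommRing R] [Algebra ℂ R] (α : B.functionField →ₐ[ℂ] R)
        (ψ : PluckerRing p N →ₐ[ℂ] R) (hI : IsUnit (ψ (coord p N I))),
        sectionValue hK s hi I α (awayLiftAlgHom I ψ hI) * ψ (coord p N I) ^ r =
          Algebra.TensorProduct.lift α ψ (fun _ _ => .all _ _) w := by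
  obtain ⟨r, w, hw, h⟩ := exists_mul_pow_eq (p := p) (N := N) I (K := B.functionField)
    (sectionValue hK s hi I Algebra.TensorProduct.includeLeft
      Algebra.TensorProduct.includeRight)
  refine ⟨r, w, hw, fun α ψ hI => ?_⟩
  have h1 : (Algebra.TensorProduct.lift α (awayLiftAlgHom I ψ hI) (fun _ _ => .all _ _)).comp
      Algebra.TensorProduct.includeRight = awayLiftAlgHom I ψ hI := by
    ext x; simp
  rw [← h α ψ hI, ← sectionValue_comp, Algebra.TensorProduct.lift_comp_includeLeft, h1]

/-- A section of `𝒪_G(k) ⊗ L` over the generic point of `B` is given by a homogeneous polynomial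
in the matrix entries. -/
lemma exists_polynomial (hpN : p < N) (s : (twist b p N k L).GlobalSection) {i : L.ι}
    (hi : genericPoint B ∈ L.U i) :
    ∃ F : MvPolynomial (Fin (p + 1) × Fin (N + 1)) B.functionField,
      F.IsHomogeneous ((p + 1) * k) ∧ ∀ I : PluckerIndex p N,
        ∃ (r : ℕ) (w : B.functionField ⊗[ℂ] PluckerRing p N),
          F * minorOver B.functionField p N I ^ r =
            minorOver B.functionField p N I ^ k * pluckerEval p N B.functionField w ∧
          ∀ {R : Type} [CommRing R] [Algebra ℂ R] (α : B.functionField →ₐ[ℂ] R)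
            (ψ : PluckerRing p N →ₐ[ℂ] R) (hI : IsUnit (ψ (coord p N I))),
            sectionValue hK s hi I α (awayLiftAlgHom I ψ hI) * ψ (coord p N I) ^ r =
              Algebra.TensorProduct.lift α ψ (fun _ _ => .all _ _) w := by
  set K := B.functionField
  let A := MvPolynomial (Fin (p + 1) × Fin (N + 1)) K
  let E := FractionRing A
  let ι : A →ₐ[ℂ] E := IsScalarTower.toAlgHom ℂ A E
  have hι : Function.Injective ι := IsFractionRing.injective A E
  -- The point given by the generic matrix over the fraction field: all minors are invertible there,
  -- so all charts can be compared.
  let ψ : PluckerRing p N →ₐ[ℂ] E := ι.comp (pluckerToPolynomial p N K)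
  let α : K →ₐ[ℂ] E := ι.comp (IsScalarTower.toAlgHom ℂ K A)
  have hψ : ∀ I, ψ (coord p N I) = ι (minorOver K p N I) := fun I =>
    congrArg ι (pluckerToPolynomial_coord p N K I)
  have hu : ∀ I, IsUnit (ψ (coord p N I)) := fun I => by
    rw [isUnit_iff_ne_zero, hψ]
    exact fun h => minorOver_ne_zero K p N I ((map_eq_zero_iff _ hι).mp h)
  choose r w hw h using exists_sectionValue_mul_pow_eq hK s hi (p := p) (N := N)
  have hlift : ∀ w, Algebra.TensorProduct.lift α ψ (fun _ _ => .all _ _) w =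
      ι (pluckerEval p N K w) := by
    have h1 : Algebra.TensorProduct.lift α ψ (fun _ _ => .all _ _) =
        ι.comp (pluckerEval p N K) := by
      apply Algebra.TensorProduct.ext
      · ext x; simp [α]; rfl
      · ext x; simp [ψ]
    exact fun w => congr($h1 w)
  let v : PluckerIndex p N → E := fun I => sectionValue hK s hi I α (awayLiftAlgHom I ψ (hu I))
  have hv : ∀ I, v I * ι (minorOver K p N I) ^ r I = ι (pluckerEval p N K (w I)) := fun I => by
    rw [← hψ, ← hlift]
    exact h I α ψ (hu I)
  have hvv : ∀ I J, v I * ι (minorOver K p N I) ^ k = v J * ι (minorOver K p N J) ^ k := by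
    intro I J
    rw [← hψ, ← hψ]
    exact sectionValue_mul_pow hK s hi I J α ψ (hu I) (hu J)
  obtain ⟨I₁, I₂, h12⟩ := exists_disjoint_pluckerIndex hpN
  have hv' : ∀ I, v I₁ * ι (minorOver K p N I₁) ^ k * ι (minorOver K p N I) ^ r I =
      ι (minorOver K p N I ^ k * pluckerEval p N K (w I)) := fun I => by
    rw [hvv I₁ I, map_mul, map_pow, ← hv]
    ring
  -- `F` is the common value of `v I * x_I ^ k`. It becomes a polynomial after multiplication by
  -- powers of two relatively prime minors, hence is one itself.
  obtain ⟨F, hF⟩ := exists_algebraMap_eq_of_isRelPrime (E := E) (isRelPrime_minorOver K p N h12)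
    (minorOver_ne_zero K p N I₁) (r I₁) (r I₂) (hv' I₁) (hv' I₂)
  have hF' : ∀ I, F * minorOver K p N I ^ r I =
      minorOver K p N I ^ k * pluckerEval p N K (w I) := fun I => by
    apply hι
    rw [← hv' I, ← hF, map_mul, map_pow]
    rfl
  refine ⟨F, ?_, fun I => ⟨r I, w I, hF' I, fun α ψ hI => h I α ψ hI⟩⟩
  have h1 := (minorOver_isHomogeneous K p N I₁).pow (r I₁)
  refine isHomogeneous_of_mul h1 (pow_ne_zero _ (minorOver_ne_zero K p N I₁)) ?_
  rw [mul_comm, hF', add_comm ((p + 1) * r I₁)]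
  exact ((minorOver_isHomogeneous K p N I₁).pow k).mul (pluckerEval_isHomogeneous p N K (hw I₁))

end Polynomial

/-! ### Points of the common zero scheme -/

section CommonZero

lemma evalAt_eq_zero_iff_of_field {K : Type} [Field K] {X : Scheme.{0}} (P : Spec (.of K) ⟶ X)
    (U : X.Opens) (h : ⊤ ≤ P ⁻¹ᵁ U) {a : Γ(X, U)} (ha : evalAt P U h a = 0) :
    (P.app U).hom a = 0 := by
  have h1 : (P.appLE U ⊤ h).hom a = 0 :=
    (map_eq_zero_iff _ ((ConcreteCategory.bijective_of_isIso
      (Scheme.ΓSpecIso (.of K)).hom).injective)).mp ha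
  have h2 : ∀ {W : (Spec (.of K)).Opens} (hW : ⊤ ≤ W) (z : Γ(Spec (.of K), W)),
      ((Spec (.of K)).presheaf.map (homOfLE hW).op).hom z = 0 → z = 0 := by
    intro W hW z hz
    obtain rfl : W = ⊤ := top_le_iff.mp hW
    have h3 : (homOfLE hW).op = 𝟙 _ := rfl
    rw [h3, (Spec (.of K)).presheaf.map_id] at hz
    exact hz
  exact h2 h _ h1

/-- `Spec K` has a single point, so an affine `U` either misses its image, where there is nothing to
check, or can be shrunk around it until all `M m` are trivialized and the generators of the ideal
are known. -/
lemma IsCommonZeroScheme.ker_le {X H : Scheme.{0}} {c : ℕ} {M : Fin c → LineBundle X}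
    {σ : ∀ m, (M m).GlobalSection} {h : H ⟶ X} (hH : IsCommonZeroScheme σ h)
    {K : Type} [Field K] (P : Spec (.of K) ⟶ X) (i : ∀ m, (M m).ι)
    (hi : ∀ m, ⊤ ≤ P ⁻¹ᵁ (M m).U (i m))
    (h0 : ∀ m, evalAt P _ (hi m) ((σ m).s (i m)) = 0) : h.ker ≤ P.ker := by
  refine Scheme.IdealSheafData.le_ofIdeals_iff.mpr fun U a ha => ?_
  rw [RingHom.mem_ker]
  let x₀ : Spec (.of K) := (default : PrimeSpectrum K)
  have hx₀ : ∀ x : Spec (.of K), x = x₀ := fun x => Subsingleton.elim (α := PrimeSpectrum K) _ _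
  by_cases hU : P x₀ ∈ U.1
  · let W : X.Opens := U.1 ⊓ ⨅ m, (M m).U (i m)
    have hW : P x₀ ∈ W := by
      refine ⟨hU, ?_⟩
      rw [TopologicalSpace.Opens.coe_iInf, Set.mem_iInter]
      exact fun m => hi m (x := x₀) trivial
    obtain ⟨V, hV, hxV, hVW⟩ := exists_isAffineOpen_mem_and_subset hW
    have hVi : ∀ m, V ≤ (M m).U (i m) := fun m =>
      (show V ≤ W from hVW).trans (inf_le_right.trans (iInf_le _ m))
    have hVU : V ≤ U.1 := (show V ≤ W from hVW).trans inf_le_left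
    have hPV : ⊤ ≤ P ⁻¹ᵁ V := fun x _ => by rw [hx₀ x]; exact hxV
    have h1 : res hVU a ∈ h.ker.ideal ⟨V, hV⟩ :=
      Scheme.IdealSheafData.ideal_le_comap_ideal (U := ⟨V, hV⟩) (V := U) h.ker hVU ha
    rw [hH.ideal_eq ⟨V, hV⟩ i hVi] at h1
    have h2 : Ideal.span (Set.range fun m => res (hVi m) ((σ m).s (i m))) ≤
        RingHom.ker (evalAt P V hPV) := by
      rw [Ideal.span_le]
      rintro _ ⟨m, rfl⟩
      exact (evalAt_res P (hVi m) hPV _).trans (h0 m)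
    have h3 := h2 h1
    rw [RingHom.mem_ker, evalAt_res] at h3
    exact evalAt_eq_zero_iff_of_field P U.1 _ h3
  · have h1 : P ⁻¹ᵁ U.1 = ⊥ := by
      ext x
      rw [hx₀ x]
      exact ⟨fun h => hU h, fun h => h.elim⟩
    have h2 : ∀ {W : (Spec (.of K)).Opens} (_ : W = ⊥) (z : Γ(Spec (.of K), W)), z = 0 := by
      rintro _ rfl z
      exact Subsingleton.elim _ _
    exact h2 h1 _

end CommonZero

/-! ### The point of the common zero scheme over the function field -/

section Point

open HomogeneousLocalization TensorProduct MvPolynomial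

variable {p N : ℕ} {B : Scheme.{0}} [IsIntegral B] {b : B ⟶ Spec (.of ℂ)}

lemma LineBundle.exists_mem {X : Scheme.{0}} (L : LineBundle X) (x : X) : ∃ i, x ∈ L.U i := by
  have h1 : x ∈ ⨆ i, L.U i := L.cover ▸ trivial
  exact TopologicalSpace.Opens.mem_iSup.mp h1

/-- The common zero scheme of the sections has a point over the function field of `B`. -/
lemma exists_point [SmoothOfRelativeDimension 1 b] (hpN : p < N) {c : ℕ} {k : Fin c → ℕ}
    (hk : ∀ m, 0 < k m) (hsum : ∑ m, k m < N + 1) {L : Fin c → LineBundle B}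
    {σ : ∀ m, (twist b p N (k m) (L m)).GlobalSection} {H : Scheme.{0}} {h : H ⟶ prodGr b p N}
    (hH : IsCommonZeroScheme σ h) : ∃ y : Spec B.functionField ⟶ H,
      y ≫ h ≫ prodGr.fst b p N = B.fromSpecStalk (genericPoint B) := by
  let : Algebra ℂ B.functionField := (toFunctionField b).toAlgebra
  have hK : algebraMap ℂ B.functionField = toFunctionField b := rfl
  obtain ⟨Φ⟩ := exists_poleFiltration_functionField b hK
  choose i hi using fun m => (L m).exists_mem (genericPoint B)
  choose F hF hF' using fun m => exists_polynomial hK hpN (σ m) (hi m)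
  obtain ⟨Q, Θ, hQ, hΘ, I, hI, hΘI⟩ := Φ.exists_zero hpN k hk hsum F hF
  let ρ : PluckerRing p N →ₐ[ℂ] Q :=
    ((pluckerToPolynomial p N B.functionField).codRestrict (Q.restrictScalars ℂ)
      (pluckerToPolynomial_mem p N B.functionField hQ))
  -- The algebra `Q` contains the image of the Plücker ring, so `Θ` restricts to homogeneous
  -- coordinates of a `K`-point of the Grassmannian.
  let ψ : PluckerRing p N →ₐ[ℂ] B.functionField := (Θ.restrictScalars ℂ).comp ρ
  have hρ : ∀ J, ρ (coord p N J) = ⟨minorOver B.functionField p N J, hQ J⟩ := fun J =>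
    Subtype.ext (pluckerToPolynomial_coord p N B.functionField J)
  have hψ : ψ (coord p N I) ≠ 0 := fun h0 => hΘI ((congrArg Θ (hρ I)).symm.trans h0)
  have hψ' : IsUnit (ψ (coord p N I)) := isUnit_iff_ne_zero.mpr hψ
  have hzero : ∀ m, sectionValue hK (σ m) (hi m) I (AlgHom.id ℂ _) (awayLiftAlgHom I ψ hψ') = 0 := by
    intro m
    obtain ⟨r, w, hw, hv⟩ := hF' m I
    obtain ⟨hFQ, hΘF⟩ := hΘ m
    let G : Q := Algebra.TensorProduct.lift (IsScalarTower.toAlgHom ℂ B.functionField Q) ρ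
      (fun _ _ => .all _ _) w
    have hG : (G : MvPolynomial _ B.functionField) = pluckerEval p N B.functionField w := by
      have h1 : (Q.val.restrictScalars ℂ).comp
          (Algebra.TensorProduct.lift (IsScalarTower.toAlgHom ℂ B.functionField Q) ρ
            (fun _ _ => .all _ _)) = pluckerEval p N B.functionField := by
        apply Algebra.TensorProduct.ext
        · ext x; simp
        · ext x; simp; rfl
      exact congr($h1 w)
    have hΘG : Θ G = Algebra.TensorProduct.lift (AlgHom.id ℂ _) ψ (fun _ _ => .all _ _) w := by
      have h1 : (Θ.restrictScalars ℂ).comp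
          (Algebra.TensorProduct.lift (IsScalarTower.toAlgHom ℂ B.functionField Q) ρ
            (fun _ _ => .all _ _)) =
          Algebra.TensorProduct.lift (AlgHom.id ℂ _) ψ (fun _ _ => .all _ _) := by
        apply Algebra.TensorProduct.ext
        · ext x; simp
        · ext x; simp [ψ]
      exact congr($h1 w)
    -- This identity already holds inside `Q`, so `Θ` applies to it even though it need not be
    -- defined on all polynomials; as `Θ` kills `F m` and `x_I` has nonzero value, the section
    -- vanishes.
    have h1 : (⟨F m, hFQ⟩ : Q) * ρ (coord p N I) ^ r = ρ (coord p N I) ^ k m * G := by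
      apply Subtype.ext
      simp only [hρ, Subalgebra.coe_mul, Subalgebra.coe_pow, hG]
      exact hw
    have h2 := congrArg Θ h1
    rw [map_mul, hΘF, zero_mul, map_mul, map_pow, hΘG, ← hv (AlgHom.id ℂ _) ψ hψ'] at h2
    have h3 : ψ (coord p N I) ^ k m * (sectionValue hK (σ m) (hi m) I (AlgHom.id ℂ _)
      (awayLiftAlgHom I ψ hψ') * ψ (coord p N I) ^ r) = 0 := h2.symm
    rw [mul_eq_zero, mul_eq_zero] at h3
    exact (h3.resolve_left (pow_ne_zero _ hψ)).resolve_right (pow_ne_zero _ hψ)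
  let P := chartPoint hK I (AlgHom.id ℂ _) (awayLiftAlgHom I ψ hψ')
  have := hH.isClosedImmersion
  have hker : h.ker ≤ P.ker := hH.ker_le P (fun m => (I, i m))
    (fun m => top_le_preimage_chartPoint hK (k m) I _ _ (hi m)) hzero
  refine ⟨IsClosedImmersion.lift h P hker, ?_⟩
  rw [IsClosedImmersion.lift_fac_assoc]
  refine (chartPoint_fst hK I _ _).trans ?_
  exact (congrArg (· ≫ B.fromSpecStalk (genericPoint B)) (Spec.map_id _)).trans (Category.id_comp _)

end Point

end GrassTsen

end

theorem proposition4p2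
    -- the Grassmannian of `p`-planes in `ℙ^N`
    (p N : ℕ) (hpN : p < N)
    -- a smooth complete irreducible curve `B` over `ℂ`
    (B : Scheme.{0}) (b : B ⟶ Spec (.of ℂ)) [AlgebraicGeometry.IsIntegral B]
    [AlgebraicGeometry.IsProper b] [AlgebraicGeometry.SmoothOfRelativeDimension 1 b]
    -- degrees, line bundles on `B`, and sections of `𝒪_G(k m) ⊗ L m`
    (c : ℕ) (k : Fin c → ℕ) (hk : ∀ m, 0 < k m) (hsum : ∑ m, k m < N + 1)
    (L : Fin c → GrassTsen.LineBundle B)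
    (σ : ∀ m, (GrassTsen.twist b p N (k m) (L m)).GlobalSection)
    -- their common zero scheme `H` in `B × G`
    (H : Scheme.{0}) (h : H ⟶ GrassTsen.prodGr b p N)
    (hH : GrassTsen.IsCommonZeroScheme σ h)
    -- over a nonempty open subset of `B`, it is smooth of relative dimension `dim G - c`
    (hsmooth : ∃ U : B.Opens, (U : Set B).Nonempty ∧
      AlgebraicGeometry.SmoothOfRelativeDimension ((p + 1) * (N - p) - c)
        ((h ≫ GrassTsen.prodGr.fst b p N) ∣_ U)) :
    ∃ s : B ⟶ H, s ≫ h ≫ GrassTsen.prodGr.fst b p N = 𝟙 B := by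
  obtain ⟨y, hy⟩ := GrassTsen.exists_point hpN hk hsum hH
  have := hH.isClosedImmersion
  have : B.IsSeparated := ⟨by
    have h1 : Limits.terminal.from B = b ≫ Limits.terminal.from _ := Limits.terminal.hom_ext _ _
    rw [h1]; infer_instance⟩
  exact GrassTsen.exists_section_of_point (h ≫ GrassTsen.prodGr.fst b p N)
    (GrassTsen.valuationRing_stalk b) y hy
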